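/- **Proposition 1.3.** Fix $\beta>0$. For $n\ge 2$ and $1\le i\le n$ let $a_{n,i},b_{n,i},c_{n,i}$ be real numbers such that the following matrix $K_{n,i}$ on $\{0,1,\dots,2n\}$ is an irreducible stochastic matrix: $$K_{n,i}(j,j+1)=1-a_{n,i}\ \ (0\le j<2n,\ j\ne n),\qquad K_{n,i}(0,0)=a_{n,i},\qquad K_{n,i}(j,j-1)=a_{n,i}\ \ (1\le j\le 2n),$$ $$K_{n,i}(n,n+1)=b_{n,i}n^{-\beta},\qquad K_{n,i}(n,2n)=1-a_{n,i}-b_{n,i}n^{-\beta},$$ $$K_{n,i}(2n,n)=c_{n,i},\qquad K_{n,i}(2n,2n)=1-a_{n,i}-c_{n,i},$$ all other entries being $0$. Let $\pi_{n,i}$ be its stationary distribution, and assume the reversibility condition $$b_{n,i}c_{n,i}(1-a_{n,i})^{n-1}n^{-\beta}=(1-a_{n,i}-b_{n,i}n^{-\beta})\,a_{n,i}^{\,n}.$$ Suppose that there is $C>1$ such that, for all $n\ge 2$ and $1\le i\le n$, $$\sum_{k=1}^n a_{n,k}\le C n^{-\beta-1},\qquad C^{-1}\le b_{n,i}\le C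 .$$ For positive weights $p_{n,1},\dots,p_{n,n}$ put $q_n=p_{n,1}+\cdots+p_{n,n}$, $\mathcal X_n=\{0,\dots,2n\}^n$, $\pi_n=\pi_{n,1}\times\cdots\times\pi_{n,n}$ and $$K_n=\sum_{i=1}^n\frac{p_{n,i}}{q_n}\,I\otimes\cdots\otimes I\otimes K_{n,i}\otimes I\otimes\cdots\otimes I\qquad(K_{n,i}\text{ in the }i\text{-th place}).$$ Let $H_{n,t}=e^{-t(I-K_n)}$ and $d_n(t)=\sup_{x\in\mathcal X_n,\,A\subset\mathcal X_n}\{H_{n,t}(x,A)-\pi_n(A)\}$ for $t\ge0$. A sequence $(t_n)$ with $t_n>0$ for all large $n$ is called a *cutoff time* if $d_n(rt_n)\to0$ for every $r>1$ and $d_n(rt_n)\to1$ for every $r\in(0,1)$; the family of continuous time chains $(\mathcal X_n,H_{n,t},\pi_n)_{n}$ is said to have a *total variation cutoff* if it has a cutoff time. Then the following hold. 1. For $p_{n,i}=1+2^{i-n}$, there is a total variation cutoff if and only if $\beta\ne1$. If $\beta\in(0,1)$, then $2n^2$ is a cutoff time; if $\beta\in(1,\infty)$, then $n^2$ is a cutoff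 time. 2. For every $\alpha>0$ and $p_{n,i}=1+(i/n)^\alpha$, there is a total variation cutoff if and only if $\beta\ne1$. If $\beta\in(0,1)$, then $2\,\frac{\alpha+2}{\alpha+1}\,n^2$ is a cutoff time; if $\beta\in(1,\infty)$, then $\frac{\alpha+2}{\alpha+1}\,n^2$ is a cutoff time. 3. For $p_{n,i}=1+\log i/\log n$, for every $\beta>0$ there is a total variation cutoff, with cutoff time $4n^2/(1+\min\{\beta,1\})$. -/

import Mathlib

open Filter Topology

noncomputable section

/-- The Lacoin-type transition matrix on `{0, 1, …, 2n}` (meaningful for `n ≥ 2`).  Nearest-neighbour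
moves go right with probability `1 - a` and left with probability `a` (with holding `a` at `0`),
except that from `n` one moves to `n + 1` with probability `b * n ^ (-β)` and jumps to `2n` with
probability `1 - a - b * n ^ (-β)`, and from `2n` one jumps to `n` with probability `c` and stays
with probability `1 - a - c`. -/
def lacoinKernel (β : ℝ) (n : ℕ) (a b c : ℝ) :
    Matrix (Fin (2 * n + 1)) (Fin (2 * n + 1)) ℝ := fun j k =>
  if (j : ℕ) = n then
    if (k : ℕ) + 1 = j then a
    else if (k : ℕ) = n + 1 then b * (n : ℝ) ^ (-β)
    else if (k : ℕ) = 2 * n then 1 - a - b * (n : ℝ) ^ (-β)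
    else 0
  else if (j : ℕ) = 2 * n then
    if (k : ℕ) + 1 = j then a
    else if (k : ℕ) = n then c
    else if (k : ℕ) = 2 * n then 1 - a - c
    else 0
  else
    if (k : ℕ) = j + 1 then 1 - a
    else if (k : ℕ) + 1 = j then a
    else if (j : ℕ) = 0 ∧ (k : ℕ) = 0 then a
    else 0

/-- `π` is a probability vector with `π K = π`. -/
def IsStationaryDistribution {X : Type*} [Fintype X] (K : Matrix X X ℝ) (π : X → ℝ) : Prop :=
  π ∈ stdSimplex ℝ X ∧ Matrix.vecMul π K = π

/-- `(X, K, π)` is an irreducible Markov chain with stationary distribution `π`. -/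
def IsIrreducibleChain {X : Type*} [Fintype X] [DecidableEq X]
    (K : Matrix X X ℝ) (π : X → ℝ) : Prop :=
  K ∈ Matrix.rowStochastic ℝ X ∧ K.IsIrreducible ∧ IsStationaryDistribution K π

/-- The product transition matrix `∑ i, w i • I ⊗ ⋯ ⊗ I ⊗ K i ⊗ I ⊗ ⋯ ⊗ I`
(with `K i` at the `i`-th place). -/
def productKernel {ι : Type*} [Fintype ι] [DecidableEq ι] {X : ι → Type*}
    [∀ i, DecidableEq (X i)] (w : ι → ℝ) (K : ∀ i, Matrix (X i) (X i) ℝ) :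
    Matrix (∀ i, X i) (∀ i, X i) ℝ := fun x y =>
  ∑ i, w i * (K i (x i) (y i) *
    ∏ j ∈ Finset.univ.erase i, (1 : Matrix (X j) (X j) ℝ) (x j) (y j))

/-- The product of the probability vectors `π i`. -/
def productDistribution {ι : Type*} [Fintype ι] {X : ι → Type*} (π : ∀ i, X i → ℝ) :
    (∀ i, X i) → ℝ := fun x => ∏ i, π i (x i)

/-- The semigroup `H_t = exp (-t (I - K))` of the associated continuous time chain. -/
def heatKernel {X : Type*} [Fintype X] [DecidableEq X] (K : Matrix X X ℝ) (t : ℝ) :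
    Matrix X X ℝ :=
  NormedSpace.exp ((-t) • ((1 : Matrix X X ℝ) - K))

/-- The (maximum) total variation distance `sup_{x, A} (H_t(x, A) - π(A))` of the continuous time
chain associated with `(X, K, π)`. -/
def tvDistance {X : Type*} [Fintype X] [DecidableEq X] (K : Matrix X X ℝ) (π : X → ℝ)
    (t : ℝ) : ℝ :=
  ⨆ q : X × Finset X, (∑ y ∈ q.2, heatKernel K t q.1 y - ∑ y ∈ q.2, π y)

/-- `t` is a cutoff time for a family of continuous time chains, whose `n`-th member has
distance `d n s` to stationarity at time `s`. -/
def IsCutoffTime (d : ℕ → ℝ → ℝ) (t : ℕ → ℝ) : Prop :=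
  (∀ᶠ n in atTop, 0 < t n) ∧
  (∀ r : ℝ, 1 < r → Tendsto (fun n => d n (r * t n)) atTop (𝓝 0)) ∧
  (∀ r : ℝ, 0 < r → r < 1 → Tendsto (fun n => d n (r * t n)) atTop (𝓝 1))

/-- The family presents a cutoff if it has some cutoff time. -/
def HasCutoff (d : ℕ → ℝ → ℝ) : Prop := ∃ t : ℕ → ℝ, IsCutoffTime d t

/-- The total variation distance at time `t` of the continuous time chain associated with the
product of the chains `lacoinKernel β n (a n i) (b n i) (c n i)`, `1 ≤ i ≤ n`, according to the
probability vector `(p n 1 / q n, …, p n n / q n)`, where `q n = p n 1 + ⋯ + p n n`. -/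
def lacoinProductDistance (β : ℝ) (a b c : ℕ → ℕ → ℝ)
    (π : ∀ n : ℕ, ℕ → Fin (2 * n + 1) → ℝ) (p : ℕ → ℕ → ℝ) (n : ℕ) (t : ℝ) : ℝ :=
  tvDistance
    (productKernel (fun i : Fin n => p n (i + 1) / ∑ k ∈ Finset.Icc 1 n, p n k)
      (fun i : Fin n => lacoinKernel β n (a n (i + 1)) (b n (i + 1)) (c n (i + 1))))
    (productDistribution (fun i : Fin n => π n (i + 1))) t

end

/-!
Each component chain walks from `0` to `n` almost deterministically in about `n` of its own steps,
and from there it either jumps to `2n`, with probability about `1 - b n^{-β}`, or walks on to `2n`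
in about `n` further steps. Its stationary distribution is concentrated at `2n`. The components of
the continuous time product chain evolve independently, at speeds proportional to the weights, so
the product started at `0` is close to stationarity exactly when all components have reached `2n`.
At time `θ Q n²`, where `Q` is the limiting mean weight, a component of weight `p` has run for about
`p θ n` steps: none has arrived if `p θ < 1`, the direct jump has been made if `p θ > 1`, and the
detour is over as well if `p θ > 2`. Among the components with `p θ < 2` the number still on a
detour is of order `n^{-β}` times their number, and whether this tends to `0`, stays bounded or
tends to infinity decides about the cutoff.
-/

section HeatKernel

open scoped Matrix.Norms.Operator
open Matrix

variable {X : Type*} [Fintype X] [DecidableEq X]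

lemma heatKernel_eq_exp_smul (K : Matrix X X ℝ) (t : ℝ) :
    heatKernel K t = NormedSpace.exp (t • (K - 1)) := by
  rw [heatKernel, neg_smul, ← smul_neg, neg_sub]

lemma heatKernel_zero (K : Matrix X X ℝ) : heatKernel K 0 = 1 := by
  rw [heatKernel_eq_exp_smul, zero_smul, NormedSpace.exp_zero]

lemma heatKernel_add (K : Matrix X X ℝ) (s t : ℝ) :
    heatKernel K (s + t) = heatKernel K s * heatKernel K t := by
  simp only [heatKernel_eq_exp_smul, add_smul]
  exact NormedSpace.exp_add_of_commute (((Commute.refl _).smul_left _).smul_right _)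

lemma hasDerivAt_heatKernel (K : Matrix X X ℝ) (t : ℝ) :
    HasDerivAt (heatKernel K) ((K - 1) * heatKernel K t) t := by
  rw [funext (heatKernel_eq_exp_smul K)]
  exact hasDerivAt_exp_smul_const' (K - 1) t

lemma hasDerivAt_heatKernel_apply (K : Matrix X X ℝ) (t : ℝ) (x y : X) :
    HasDerivAt (fun s => heatKernel K s x y) (((K - 1) * heatKernel K t) x y) t :=
  hasDerivAt_pi.1 (hasDerivAt_pi.1 (hasDerivAt_heatKernel K t) x) y

theorem eq_heatKernel_of_hasDerivAt {K : Matrix X X ℝ} {W : ℝ → Matrix X X ℝ} (h0 : W 0 = 1)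
    (hW : ∀ t, HasDerivAt W ((K - 1) * W t) t) : W = heatKernel K :=
  ODE_solution_unique_univ (v := fun _ M => (K - 1) * M) (s := fun _ => Set.univ) (t₀ := 0)
    (fun _ => (ContinuousLinearMap.mul ℝ (Matrix X X ℝ) (K - 1)).lipschitz.lipschitzOnWith)
    (fun t => ⟨hW t, Set.mem_univ _⟩) (fun t => ⟨hasDerivAt_heatKernel K t, Set.mem_univ _⟩)
    (h0.trans (heatKernel_zero K).symm)

lemma heatKernel_eq_exp_neg_smul_exp (K : Matrix X X ℝ) (t : ℝ) :
    heatKernel K t = Real.exp (-t) • NormedSpace.exp (t • K) := by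
  have hscalar : NormedSpace.exp ((-t) • (1 : Matrix X X ℝ)) = Real.exp (-t) • 1 := by
    rw [← Algebra.algebraMap_eq_smul_one, ← Algebra.algebraMap_eq_smul_one, Real.exp_eq_exp_ℝ]
    exact (NormedSpace.algebraMap_exp_comm (-t)).symm
  rw [heatKernel, show (-t) • (1 - K) = (-t) • 1 + t • K by rw [smul_sub, neg_smul t K]; abel,
    Matrix.exp_add_of_commute _ _ ((Commute.one_left _).smul_left _), hscalar, smul_one_mul]

theorem hasSum_heatKernel_apply (K : Matrix X X ℝ) (t : ℝ) (x y : X) :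
    HasSum (fun m : ℕ => Real.exp (-t) * (t ^ m / m.factorial) * (K ^ m) x y)
      (heatKernel K t x y) := by
  have h : HasSum (fun m : ℕ => Real.exp (-t) • ((m.factorial : ℝ)⁻¹ • (t • K) ^ m))
      (heatKernel K t) :=
    heatKernel_eq_exp_neg_smul_exp K t ▸
      (NormedSpace.exp_series_hasSum_exp' (𝕂 := ℝ) (t • K)).const_smul _
  convert! Pi.hasSum.1 (Pi.hasSum.1 h x) y using 2 with m
  simp only [smul_pow, Matrix.smul_apply, smul_eq_mul]
  ring

end HeatKernel

section Poisson

lemma hasSum_poisson_mul_pow (t l : ℝ) :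
    HasSum (fun m : ℕ => Real.exp (-t) * (t ^ m / m.factorial) * l ^ m)
      (Real.exp (t * (l - 1))) := by
  have h := (NormedSpace.expSeries_div_hasSum_exp (t * l)).mul_left (Real.exp (-t))
  rw [← Real.exp_eq_exp_ℝ, ← Real.exp_add, show -t + t * l = t * (l - 1) by ring] at h
  convert! h using 2 with m
  rw [mul_pow]
  ring

lemma hasSum_poisson (t : ℝ) :
    HasSum (fun m : ℕ => Real.exp (-t) * (t ^ m / m.factorial)) 1 := by
  simpa using hasSum_poisson_mul_pow t 1

lemma hasSum_poisson_mul_natCast (t : ℝ) :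
    HasSum (fun m : ℕ => Real.exp (-t) * (t ^ m / m.factorial) * m) t := by
  rw [← hasSum_nat_add_iff' 1]
  simp only [Finset.range_one, Finset.sum_singleton, Nat.cast_zero, mul_zero, sub_zero]
  convert! (hasSum_poisson t).mul_left t using 2 with m
  · rw [Nat.factorial_succ]
    push_cast
    field_simp
    ring
  · exact (mul_one t).symm

theorem hasSum_poisson_mul_affine_add_pow (t A D B l : ℝ) :
    HasSum (fun m : ℕ => Real.exp (-t) * (t ^ m / m.factorial) * (A + D * m + B * l ^ m))
      (A + D * t + B * Real.exp (t * (l - 1))) := by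
  convert! (((hasSum_poisson t).mul_left A).add ((hasSum_poisson_mul_natCast t).mul_left D)).add
    ((hasSum_poisson_mul_pow t l).mul_left B) using 1
  · funext m
    ring
  · ring

/-- The base of the Chernoff bound for the Poisson law: a Poisson variable of mean `s` is at most
`s / (1 + ε)` (if `0 < ε`), or at least `s / (1 + ε)` (if `-1 < ε < 0`), with probability at most
`chernoffRate ε ^ (s / (1 + ε))`. -/
noncomputable def chernoffRate (ε : ℝ) : ℝ := (1 + ε) * Real.exp (-ε)

lemma chernoffRate_nonneg {ε : ℝ} (hε : -1 ≤ ε) : 0 ≤ chernoffRate ε :=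
  mul_nonneg (by linarith) (Real.exp_pos _).le

lemma chernoffRate_lt_one {ε : ℝ} (hε : ε ≠ 0) : chernoffRate ε < 1 := by
  rw [chernoffRate, Real.exp_neg, ← div_eq_mul_inv, div_lt_one (Real.exp_pos _), add_comm]
  exact Real.add_one_lt_exp hε

lemma pow_mul_exp_le_chernoffRate_pow {s ε : ℝ} {N : ℕ} (hε : -1 < ε)
    (hs : ε * ((1 + ε) * N) ≤ ε * s) :
    (1 + ε) ^ N * Real.exp (s * ((1 + ε)⁻¹ - 1)) ≤ chernoffRate ε ^ N := by
  have h1 : 0 < 1 + ε := by linarith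
  rw [chernoffRate, mul_pow, ← Real.exp_nat_mul]
  refine mul_le_mul_of_nonneg_left (Real.exp_le_exp.2 ?_) (by positivity)
  calc s * ((1 + ε)⁻¹ - 1) = -(ε * s) / (1 + ε) := by field_simp; ring
    _ ≤ -(ε * ((1 + ε) * N)) / (1 + ε) := by gcongr
    _ = N * -ε := by field_simp

lemma one_le_pow_mul_inv_pow_of_le {r : ℝ} (hr : 1 ≤ r) {m N : ℕ} (h : m ≤ N) :
    1 ≤ r ^ N * r⁻¹ ^ m := by
  rw [inv_pow, ← div_eq_mul_inv, one_le_div (by positivity)]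
  exact pow_le_pow_right₀ hr h

lemma one_le_pow_mul_inv_pow_of_ge {r : ℝ} (hr0 : 0 < r) (hr : r ≤ 1) {m N : ℕ} (h : N ≤ m) :
    1 ≤ r ^ N * r⁻¹ ^ m := by
  rw [inv_pow, ← div_eq_mul_inv, one_le_div (by positivity)]
  exact pow_le_pow_of_le_one hr0.le hr h

end Poisson

section StochasticHeatKernel

open Matrix

variable {X : Type*} [Fintype X] [DecidableEq X] {K : Matrix X X ℝ} (hK : K ∈ rowStochastic ℝ X)

include hK

theorem heatKernel_mem_rowStochastic {t : ℝ} (ht : 0 ≤ t) : heatKernel K t ∈ rowStochastic ℝ X := by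
  rw [mem_rowStochastic_iff_sum]
  refine ⟨fun x y => (hasSum_heatKernel_apply K t x y).nonneg fun m => ?_, fun x => ?_⟩
  · have := nonneg_of_mem_rowStochastic (pow_mem hK m) (i := x) (j := y)
    positivity
  · refine (hasSum_sum fun y _ => hasSum_heatKernel_apply K t x y).unique ?_
    convert! hasSum_poisson t using 2 with m
    rw [← Finset.mul_sum, sum_row_of_mem_rowStochastic (pow_mem hK m), mul_one]

theorem le_heatKernel_apply_of_le_pow_apply {x y : X} {A D s ε : ℝ} {N : ℕ} (hA : 0 ≤ A)
    (hD : 0 ≤ D) (hε : 0 < ε) (hs : (1 + ε) * N ≤ s)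
    (h : ∀ m, N < m → 1 - A - D * m ≤ (K ^ m) x y) :
    1 - A - D * s - chernoffRate ε ^ N ≤ heatKernel K s x y := by
  have hs0 : 0 ≤ s := le_trans (by positivity) hs
  have hpow : ∀ m : ℕ, 1 - A + -D * m + -(1 + ε) ^ N * (1 + ε)⁻¹ ^ m ≤ (K ^ m) x y := by
    intro m
    rcases le_or_gt m N with hm | hm
    · have := one_le_pow_mul_inv_pow_of_le (by linarith : 1 ≤ 1 + ε) hm
      have := nonneg_of_mem_rowStochastic (pow_mem hK m) (i := x) (j := y)
      have : 0 ≤ D * m := by positivity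
      linarith
    · have : 0 ≤ (1 + ε) ^ N * (1 + ε)⁻¹ ^ m := by positivity
      linarith [h m hm]
  have hmean := hasSum_le (fun m => mul_le_mul_of_nonneg_left (hpow m) (by positivity))
    (hasSum_poisson_mul_affine_add_pow s _ _ _ _) (hasSum_heatKernel_apply K s x y)
  have htail := pow_mul_exp_le_chernoffRate_pow (by linarith : -1 < ε)
    (mul_le_mul_of_nonneg_left hs hε.le)
  linarith

theorem heatKernel_apply_le_of_pow_apply_le {x y : X} {B D s ε : ℝ} {N : ℕ} (hB : 0 ≤ B)
    (hD : 0 ≤ D) (hε : 0 < ε) (hε1 : ε < 1) (hs0 : 0 ≤ s) (hs : s ≤ (1 - ε) * N)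
    (h : ∀ m < N, (K ^ m) x y ≤ 1 - B * (1 - D * m)) :
    heatKernel K s x y ≤ 1 - B * (1 - D * s - chernoffRate (-ε) ^ N) := by
  have h1 : 0 < 1 + -ε := by linarith
  have hpow : ∀ m : ℕ, (K ^ m) x y
      ≤ 1 - B + B * D * m + B * (1 + -ε) ^ N * (1 + -ε)⁻¹ ^ m := by
    intro m
    rcases lt_or_ge m N with hm | hm
    · have : 0 ≤ B * (1 + -ε) ^ N * (1 + -ε)⁻¹ ^ m := by positivity
      linarith [h m hm]
    · have := mul_le_mul_of_nonneg_left
        (one_le_pow_mul_inv_pow_of_ge h1 (by linarith : 1 + -ε ≤ 1) hm) hB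
      have := le_one_of_mem_rowStochastic (pow_mem hK m) (i := x) (j := y)
      have : 0 ≤ B * D * m := by positivity
      linarith
  have hmean := hasSum_le (fun m => mul_le_mul_of_nonneg_left (hpow m) (by positivity))
    (hasSum_heatKernel_apply K s x y) (hasSum_poisson_mul_affine_add_pow s _ _ _ _)
  have htail := pow_mul_exp_le_chernoffRate_pow (s := s) (N := N) (by linarith : -1 < -ε)
    (mul_le_mul_of_nonpos_left (by linarith) (by linarith))
  linarith [mul_le_mul_of_nonneg_left htail hB]

end StochasticHeatKernel

section TotalVariation

open Matrix

variable {X : Type*} [Fintype X] [DecidableEq X] {K : Matrix X X ℝ} {π : X → ℝ} {t : ℝ}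

lemma le_tvDistance (K : Matrix X X ℝ) (π : X → ℝ) (t : ℝ) (x : X) (A : Finset X) :
    ∑ y ∈ A, heatKernel K t x y - ∑ y ∈ A, π y ≤ tvDistance K π t :=
  le_ciSup (f := fun q : X × Finset X => ∑ y ∈ q.2, heatKernel K t q.1 y - ∑ y ∈ q.2, π y)
    (Set.finite_range _).bddAbove (x, A)

lemma tvDistance_nonneg [Nonempty X] (K : Matrix X X ℝ) (π : X → ℝ) (t : ℝ) :
    0 ≤ tvDistance K π t := by
  simpa using le_tvDistance K π t (Classical.arbitrary X) ∅

theorem tvDistance_le_of_le_apply [Nonempty X] (hK : K ∈ rowStochastic ℝ X)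
    (hπ : π ∈ stdSimplex ℝ X) (ht : 0 ≤ t) {z : X} {P : ℝ} (hP : ∀ x, P ≤ heatKernel K t x z)
    (hz : P ≤ π z) : tvDistance K π t ≤ 1 - P := by
  have hH := heatKernel_mem_rowStochastic hK ht
  have hHsum : ∀ x, ∀ B : Finset X, ∑ y ∈ B, heatKernel K t x y ≤ 1 := fun x B =>
    (Finset.sum_le_univ_sum_of_nonneg fun y => hH.1 x y).trans_eq
      (sum_row_of_mem_rowStochastic hH x)
  refine ciSup_le fun ⟨x, A⟩ => ?_
  by_cases hzA : z ∈ A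
  · have hπA : π z ≤ ∑ y ∈ A, π y := Finset.single_le_sum (fun y _ => hπ.1 y) hzA
    linarith [hHsum x A]
  · have hHA := hHsum x (insert z A)
    rw [Finset.sum_insert hzA] at hHA
    have hπA : 0 ≤ ∑ y ∈ A, π y := Finset.sum_nonneg fun y _ => hπ.1 y
    linarith [hP x]

theorem sub_le_tvDistance (hK : K ∈ rowStochastic ℝ X) (hπ : π ∈ stdSimplex ℝ X) (ht : 0 ≤ t)
    (x z : X) : π z - heatKernel K t x z ≤ tvDistance K π t := by
  have hH := Finset.sum_erase_add Finset.univ (heatKernel K t x) (Finset.mem_univ z)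
  have hπz := Finset.sum_erase_add Finset.univ π (Finset.mem_univ z)
  rw [sum_row_of_mem_rowStochastic (heatKernel_mem_rowStochastic hK ht)] at hH
  rw [hπ.2] at hπz
  linarith [le_tvDistance K π t x (Finset.univ.erase z)]

theorem tvDistance_antitone [Nonempty X] (hK : K ∈ rowStochastic ℝ X) (π : X → ℝ) :
    Antitone (tvDistance K π) := by
  intro s t hst
  have hH := heatKernel_mem_rowStochastic hK (sub_nonneg.2 hst)
  have hmean : ∀ x, ∀ r : ℝ, ∑ w, heatKernel K (t - s) x w * r = r := fun x r => by
    rw [← Finset.sum_mul, sum_row_of_mem_rowStochastic hH, one_mul]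
  refine ciSup_le fun ⟨x, A⟩ => ?_
  have hmarkov : ∑ y ∈ A, heatKernel K t x y
      = ∑ w, heatKernel K (t - s) x w * ∑ y ∈ A, heatKernel K s w y := by
    conv_lhs => rw [← sub_add_cancel t s, heatKernel_add]
    simp only [Matrix.mul_apply, Finset.mul_sum]
    exact Finset.sum_comm
  calc ∑ y ∈ A, heatKernel K t x y - ∑ y ∈ A, π y
      = ∑ w, heatKernel K (t - s) x w * (∑ y ∈ A, heatKernel K s w y - ∑ y ∈ A, π y) := by
        simp only [mul_sub, Finset.sum_sub_distrib, hmean, hmarkov]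
    _ ≤ ∑ w, heatKernel K (t - s) x w * tvDistance K π s := by
        gcongr with w
        · exact hH.1 x w
        · exact le_tvDistance K π s w A
    _ = tvDistance K π s := hmean x _

end TotalVariation

section ProductChain

open Matrix

variable {ι : Type*} [Fintype ι] [DecidableEq ι] {Y : ι → Type*}

theorem productDistribution_mem_stdSimplex [∀ i, Fintype (Y i)] {π : ∀ i, Y i → ℝ}
    (hπ : ∀ i, π i ∈ stdSimplex ℝ (Y i)) :
    productDistribution π ∈ stdSimplex ℝ (∀ i, Y i) :=
  ⟨fun _ => Finset.prod_nonneg fun i _ => (hπ i).1 _,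
    (Fintype.prod_sum π).symm.trans (Finset.prod_eq_one fun i _ => (hπ i).2)⟩

variable [∀ i, DecidableEq (Y i)] {w : ι → ℝ} {K : ∀ i, Matrix (Y i) (Y i) ℝ}

lemma productKernel_apply_eq_sum_prod (w : ι → ℝ) (K : ∀ i, Matrix (Y i) (Y i) ℝ)
    (x y : ∀ i, Y i) :
    productKernel w K x y = ∑ i, w i *
      ∏ j, Function.update (fun j => (1 : Matrix (Y j) (Y j) ℝ)) i (K i) j (x j) (y j) := by
  refine Finset.sum_congr rfl fun i _ => ?_
  rw [← Finset.mul_prod_erase Finset.univ _ (Finset.mem_univ i), Function.update_self]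
  refine congrArg (fun P => w i * (_ * P)) (Finset.prod_congr rfl fun j hj => ?_)
  rw [Function.update_of_ne (Finset.ne_of_mem_erase hj)]

variable [∀ i, Fintype (Y i)]

theorem sum_productKernel_mul_prod (w : ι → ℝ) (K : ∀ i, Matrix (Y i) (Y i) ℝ)
    (f : ∀ i, Y i → ℝ) (x : ∀ i, Y i) :
    ∑ y, productKernel w K x y * ∏ i, f i (y i)
      = ∑ i, w i * ((∑ y, K i (x i) y * f i y) * ∏ j ∈ Finset.univ.erase i, f j (x j)) := by
  have hexpand : ∀ y : ∀ i, Y i, productKernel w K x y * ∏ j, f j (y j) = ∑ i, w i *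
      ∏ j, Function.update (fun j => (1 : Matrix (Y j) (Y j) ℝ)) i (K i) j (x j) (y j) *
        f j (y j) := fun y => by
    simp only [productKernel_apply_eq_sum_prod, Finset.sum_mul, mul_assoc,
      Finset.prod_mul_distrib]
  simp only [hexpand]
  rw [Finset.sum_comm]
  refine Finset.sum_congr rfl fun i _ => ?_
  rw [← Finset.mul_sum,
    ← Fintype.prod_sum fun j y =>
      Function.update (fun j => (1 : Matrix (Y j) (Y j) ℝ)) i (K i) j (x j) y * f j y,
    ← Finset.mul_prod_erase Finset.univ _ (Finset.mem_univ i), Function.update_self]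
  refine congrArg (fun P => w i * (_ * P)) (Finset.prod_congr rfl fun j hj => ?_)
  simp [Function.update_of_ne (Finset.ne_of_mem_erase hj), Matrix.one_apply]

theorem productKernel_mem_rowStochastic (hw : ∀ i, 0 ≤ w i) (hw1 : ∑ i, w i = 1)
    (hK : ∀ i, K i ∈ rowStochastic ℝ (Y i)) :
    productKernel w K ∈ rowStochastic ℝ (∀ i, Y i) := by
  rw [mem_rowStochastic_iff_sum]
  refine ⟨fun x y => Finset.sum_nonneg fun i _ => mul_nonneg (hw i) (mul_nonneg ((hK i).1 _ _)
    (Finset.prod_nonneg fun j _ => ?_)), fun x => ?_⟩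
  · exact nonneg_of_mem_rowStochastic (one_mem _)
  · simpa [sum_row_of_mem_rowStochastic (hK _), hw1]
      using sum_productKernel_mul_prod w K (fun _ _ => 1) x

lemma hasDerivAt_prod_heatKernel (hw1 : ∑ i, w i = 1) (K : ∀ i, Matrix (Y i) (Y i) ℝ) (t : ℝ)
    (x z : ∀ i, Y i) :
    HasDerivAt (fun t => ∏ i, heatKernel (K i) (t * w i) (x i) (z i))
      (∑ y, productKernel w K x y * ∏ i, heatKernel (K i) (t * w i) (y i) (z i)
        - ∏ i, heatKernel (K i) (t * w i) (x i) (z i)) t := by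
  have hfactor : ∀ i ∈ Finset.univ, HasDerivAt (fun t => heatKernel (K i) (t * w i) (x i) (z i))
      (((K i - 1) * heatKernel (K i) (t * w i)) (x i) (z i) * w i) t := fun i _ =>
    HasDerivAt.comp (h₂ := fun s => heatKernel (K i) s (x i) (z i)) t
      (hasDerivAt_heatKernel_apply (K i) (t * w i) (x i) (z i)) (hasDerivAt_mul_const (w i))
  have hprod : ∏ i, heatKernel (K i) (t * w i) (x i) (z i)
      = ∑ i, w i * (heatKernel (K i) (t * w i) (x i) (z i) *
        ∏ j ∈ Finset.univ.erase i, heatKernel (K j) (t * w j) (x j) (z j)) := by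
    simp only [Finset.mul_prod_erase Finset.univ
      (fun j => heatKernel (K j) (t * w j) (x j) (z j)) (Finset.mem_univ _), ← Finset.sum_mul,
      hw1, one_mul]
  convert! HasDerivAt.fun_finsetProd hfactor using 1
  rw [sum_productKernel_mul_prod w K (fun i y => heatKernel (K i) (t * w i) y (z i)), hprod,
    ← Finset.sum_sub_distrib]
  refine Finset.sum_congr rfl fun i _ => ?_
  rw [Matrix.sub_mul, Matrix.one_mul, Matrix.sub_apply, Matrix.mul_apply, smul_eq_mul]
  ring

theorem heatKernel_productKernel_apply (hw1 : ∑ i, w i = 1) (K : ∀ i, Matrix (Y i) (Y i) ℝ)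
    (t : ℝ) (x z : ∀ i, Y i) :
    heatKernel (productKernel w K) t x z = ∏ i, heatKernel (K i) (t * w i) (x i) (z i) := by
  suffices h : (fun t => Matrix.of fun x z => ∏ i, heatKernel (K i) (t * w i) (x i) (z i))
      = heatKernel (productKernel w K) by
    exact (congrFun (congrFun (congrFun h t) x) z).symm
  refine eq_heatKernel_of_hasDerivAt ?_ fun t =>
    hasDerivAt_pi.2 fun x => hasDerivAt_pi.2 fun z => ?_
  · ext x z
    simp only [zero_mul, heatKernel_zero, Matrix.of_apply, Matrix.one_apply, funext_iff,
      Fintype.prod_ite_zero, Finset.prod_const_one]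
  · rw [Matrix.sub_mul, Matrix.one_mul, Matrix.sub_apply, Matrix.mul_apply]
    exact hasDerivAt_prod_heatKernel hw1 K t x z

end ProductChain

section ProductBounds

open Matrix

lemma exp_neg_two_mul_le_one_sub {x : ℝ} (h0 : 0 ≤ x) (h : x ≤ 1 / 2) :
    Real.exp (-(2 * x)) ≤ 1 - x := by
  have hexp : 1 + 2 * x ≤ Real.exp (2 * x) := by linarith [Real.add_one_le_exp (2 * x)]
  rw [Real.exp_neg]
  refine (inv_anti₀ (by positivity) hexp).trans ?_
  rw [inv_le_iff_one_le_mul₀ (by positivity)]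
  nlinarith

variable {ι : Type*} [Fintype ι]

lemma prod_le_exp_neg_sum {f e : ι → ℝ} (h0 : ∀ i, 0 ≤ f i) (he : ∀ i, f i ≤ 1 - e i) :
    ∏ i, f i ≤ Real.exp (-∑ i, e i) := by
  rw [← Finset.sum_neg_distrib, Real.exp_sum]
  exact Finset.prod_le_prod (fun i _ => h0 i) fun i _ => (he i).trans (Real.one_sub_le_exp_neg _)

lemma exp_neg_sum_le_prod {f e : ι → ℝ} (h0 : ∀ i, 0 ≤ e i) (h1 : ∀ i, e i ≤ 1 / 2)
    (he : ∀ i, 1 - e i ≤ f i) : Real.exp (-(2 * ∑ i, e i)) ≤ ∏ i, f i := by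
  rw [Finset.mul_sum, ← Finset.sum_neg_distrib, Real.exp_sum]
  exact Finset.prod_le_prod (fun i _ => (Real.exp_pos _).le) fun i _ =>
    (exp_neg_two_mul_le_one_sub (h0 i) (h1 i)).trans (he i)

lemma one_sub_sum_le_prod {f e : ι → ℝ} (h0 : ∀ i, 0 ≤ f i) (h1 : ∀ i, f i ≤ 1)
    (he : ∀ i, 1 - e i ≤ f i) : 1 - ∑ i, e i ≤ ∏ i, f i := by
  have hprod : ∀ s : Finset ι, 1 - ∑ i ∈ s, (1 - f i) ≤ ∏ i ∈ s, f i := by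
    intro s
    induction s using Finset.cons_induction with
    | empty => simp
    | cons i s hi ih =>
      rw [Finset.sum_cons, Finset.prod_cons]
      nlinarith [h1 i, Finset.prod_le_one (s := s) (fun i _ => h0 i) fun i _ => h1 i]
  exact (sub_le_sub_left (Finset.sum_le_sum fun i _ => sub_le_comm.1 (he i)) 1).trans (hprod _)

variable [DecidableEq ι] {Y : ι → Type*} [∀ i, DecidableEq (Y i)] [∀ i, Fintype (Y i)]
  {w : ι → ℝ} {K : ∀ i, Matrix (Y i) (Y i) ℝ} {π : ∀ i, Y i → ℝ} {t : ℝ}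
  (hw : ∀ i, 0 ≤ w i) (hw1 : ∑ i, w i = 1) (hK : ∀ i, K i ∈ rowStochastic ℝ (Y i))
  (hπ : ∀ i, π i ∈ stdSimplex ℝ (Y i)) (ht : 0 ≤ t)

include hw hw1 hK hπ ht

theorem tvDistance_productKernel_le_one_sub_exp [Nonempty (∀ i, Y i)] {z : ∀ i, Y i} {e : ι → ℝ}
    (he : ∀ i, e i ≤ 1 / 2) (he0 : ∀ i, 0 ≤ e i)
    (hH : ∀ i x, 1 - e i ≤ heatKernel (K i) (t * w i) x (z i)) (hz : ∀ i, 1 - e i ≤ π i (z i)) :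
    tvDistance (productKernel w K) (productDistribution π) t
      ≤ 1 - Real.exp (-(2 * ∑ i, e i)) := by
  refine tvDistance_le_of_le_apply (productKernel_mem_rowStochastic hw hw1 hK)
    (productDistribution_mem_stdSimplex hπ) ht (z := z) (fun x => ?_)
    (exp_neg_sum_le_prod he0 he hz)
  rw [heatKernel_productKernel_apply hw1]
  exact exp_neg_sum_le_prod he0 he fun i => hH i (x i)

theorem prod_sub_prod_le_tvDistance_productKernel (x z : ∀ i, Y i) :
    ∏ i, π i (z i) - ∏ i, heatKernel (K i) (t * w i) (x i) (z i)
      ≤ tvDistance (productKernel w K) (productDistribution π) t := by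
  rw [← heatKernel_productKernel_apply hw1]
  exact sub_le_tvDistance (productKernel_mem_rowStochastic hw hw1 hK)
    (productDistribution_mem_stdSimplex hπ) ht x z

end ProductBounds

section StochasticPowers

open Matrix

variable {X : Type*} [Fintype X] [DecidableEq X] {K : Matrix X X ℝ} (hK : K ∈ rowStochastic ℝ X)

include hK

lemma add_mul_le_pow_succ_apply (m : ℕ) (j z : X) {k l : X} (hkl : k ≠ l) :
    K j k * (K ^ m) k z + K j l * (K ^ m) l z ≤ (K ^ (m + 1)) j z := by
  rw [pow_succ', Matrix.mul_apply, ← Finset.sum_pair hkl (f := fun k => K j k * (K ^ m) k z)]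
  exact Finset.sum_le_univ_sum_of_nonneg fun i =>
    mul_nonneg (hK.1 _ _) (nonneg_of_mem_rowStochastic (pow_mem hK m))

lemma mul_le_pow_succ_apply (m : ℕ) (j k z : X) :
    K j k * (K ^ m) k z ≤ (K ^ (m + 1)) j z := by
  rw [pow_succ', Matrix.mul_apply]
  exact Finset.single_le_sum (f := fun k => K j k * (K ^ m) k z)
    (fun i _ => mul_nonneg (hK.1 _ _) (nonneg_of_mem_rowStochastic (pow_mem hK m)))
    (Finset.mem_univ k)

lemma mul_le_one_sub_pow_succ_apply (m : ℕ) (j k z : X) :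
    K j k * (1 - (K ^ m) k z) ≤ 1 - (K ^ (m + 1)) j z := by
  have h := Finset.single_le_sum (f := fun k => K j k * (1 - (K ^ m) k z))
    (fun i _ => mul_nonneg (hK.1 _ _)
      (sub_nonneg.2 (le_one_of_mem_rowStochastic (pow_mem hK m)))) (Finset.mem_univ k)
  simpa only [mul_sub, mul_one, Finset.sum_sub_distrib, sum_row_of_mem_rowStochastic hK,
    ← Matrix.mul_apply, ← pow_succ'] using h

end StochasticPowers

lemma vecMul_pow_eq_of_isStationaryDistribution {X : Type*} [Fintype X] [DecidableEq X]
    {K : Matrix X X ℝ} {π : X → ℝ} (hπ : IsStationaryDistribution K π) (m : ℕ) :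
    Matrix.vecMul π (K ^ m) = π := by
  induction m with
  | zero => rw [pow_zero, Matrix.vecMul_one]
  | succ m ih => rw [pow_succ, ← Matrix.vecMul_vecMul, ih, hπ.2]

lemma one_sub_mul_le_pow {e : ℝ} (h : e ≤ 2) (m : ℕ) : 1 - e * m ≤ (1 - e) ^ m := by
  have := one_add_mul_le_pow (a := -e) (by linarith) m
  rw [← sub_eq_add_neg] at this
  linarith

section LacoinKernel

variable {β : ℝ} {n : ℕ} {a b c : ℝ} {j k : Fin (2 * n + 1)}

lemma lacoinKernel_apply_succ (hj : (j : ℕ) ≠ n) (hk : (k : ℕ) = j + 1) :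
    lacoinKernel β n a b c j k = 1 - a := by
  have hj2 : (j : ℕ) ≠ 2 * n := by omega
  simp [lacoinKernel, hj, hj2, hk]

lemma lacoinKernel_middle_pred (hj : (j : ℕ) = n) (hk : (k : ℕ) + 1 = n) :
    lacoinKernel β n a b c j k = a := by
  simp [lacoinKernel, hj, hk]

lemma lacoinKernel_middle_succ (hj : (j : ℕ) = n) (hk : (k : ℕ) = n + 1) :
    lacoinKernel β n a b c j k = b * (n : ℝ) ^ (-β) := by
  simp [lacoinKernel, hj, hk]
  omega

lemma lacoinKernel_middle_last (hn : 2 ≤ n) (hj : (j : ℕ) = n) :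
    lacoinKernel β n a b c j (Fin.last (2 * n)) = 1 - a - b * (n : ℝ) ^ (-β) := by
  have h1 : 2 * n + 1 ≠ n := by omega
  have h2 : 2 * n ≠ n + 1 := by omega
  simp [lacoinKernel, hj, h1, h2]

lemma lacoinKernel_last_middle (hn : 2 ≤ n) (hk : (k : ℕ) = n) :
    lacoinKernel β n a b c (Fin.last (2 * n)) k = c := by
  have h1 : 2 * n ≠ n := by omega
  have h2 : n + 1 ≠ 2 * n := by omega
  simp [lacoinKernel, hk, h1, h2]

lemma lacoinKernel_last_last (hn : 2 ≤ n) :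
    lacoinKernel β n a b c (Fin.last (2 * n)) (Fin.last (2 * n)) = 1 - a - c := by
  have h1 : 2 * n ≠ n := by omega
  simp [lacoinKernel, h1]

lemma lacoinKernel_apply_eq_zero (hj : (j : ℕ) < n) (hk : (j : ℕ) + 1 < k) :
    lacoinKernel β n a b c j k = 0 := by
  have h0 : (j : ℕ) ≠ n := by omega
  have h1 : (j : ℕ) ≠ 2 * n := by omega
  have h2 : (k : ℕ) ≠ j + 1 := by omega
  have h3 : (k : ℕ) + 1 ≠ j := by omega
  have h4 : (k : ℕ) ≠ 0 := by omega
  simp only [lacoinKernel, h0, h1, h2, h3, h4, if_false, and_false]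

theorem lacoinKernel_pow_last_eq_zero (hn : n ≠ 0) (m : ℕ) (j : Fin (2 * n + 1)) (h : m + j ≤ n) :
    (lacoinKernel β n a b c ^ m) j (Fin.last (2 * n)) = 0 := by
  induction m generalizing j with
  | zero =>
    rw [pow_zero, Matrix.one_apply_ne]
    rintro rfl
    rw [Fin.val_last] at h
    omega
  | succ m ih =>
    rw [pow_succ', Matrix.mul_apply]
    refine Finset.sum_eq_zero fun k _ => ?_
    rcases lt_or_ge ((j : ℕ) + 1) k with hk | hk
    · rw [lacoinKernel_apply_eq_zero (by omega) hk, zero_mul]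
    · rw [ih k (by omega), mul_zero]

variable (hn : 2 ≤ n) (hK : lacoinKernel β n a b c ∈ Matrix.rowStochastic ℝ (Fin (2 * n + 1)))

include hn hK

lemma lacoinKernel_left_nonneg : 0 ≤ a := by
  have h := hK.1 ⟨n, by omega⟩ ⟨n - 1, by omega⟩
  rwa [lacoinKernel_middle_pred rfl (Nat.sub_add_cancel (by omega))] at h

lemma lacoinKernel_detour_nonneg : 0 ≤ b * (n : ℝ) ^ (-β) := by
  have h := hK.1 ⟨n, by omega⟩ ⟨n + 1, by omega⟩
  rwa [lacoinKernel_middle_succ rfl rfl] at h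

lemma lacoinKernel_jump_nonneg : 0 ≤ 1 - a - b * (n : ℝ) ^ (-β) := by
  have h := hK.1 ⟨n, by omega⟩ (Fin.last (2 * n))
  rwa [lacoinKernel_middle_last hn rfl] at h

lemma lacoinKernel_return_nonneg : 0 ≤ c := by
  have h := hK.1 (Fin.last (2 * n)) ⟨n, by omega⟩
  rwa [lacoinKernel_last_middle hn rfl] at h

lemma lacoinKernel_hold_nonneg : 0 ≤ 1 - a - c := by
  have h := hK.1 (Fin.last (2 * n)) (Fin.last (2 * n))
  rwa [lacoinKernel_last_last hn] at h

theorem pow_le_one_sub_lacoinKernel_pow_last (m : ℕ) (j : Fin (2 * n + 1)) (hj : n < j)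
    (h : m + j < 2 * n) :
    (1 - a) ^ m ≤ 1 - (lacoinKernel β n a b c ^ m) j (Fin.last (2 * n)) := by
  induction m generalizing j with
  | zero =>
    rw [pow_zero, pow_zero, Matrix.one_apply_ne (by rintro rfl; simp at h), sub_zero]
  | succ m ih =>
    have h1a : 0 ≤ 1 - a := by
      linarith [lacoinKernel_jump_nonneg hn hK, lacoinKernel_detour_nonneg hn hK]
    have hstep := mul_le_one_sub_pow_succ_apply hK m j ⟨j + 1, by omega⟩ (Fin.last (2 * n))
    rw [lacoinKernel_apply_succ hj.ne' rfl] at hstep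
    rw [pow_succ']
    exact (mul_le_mul_of_nonneg_left (ih ⟨j + 1, by omega⟩ (Nat.lt_succ_of_lt hj)
      (by grind)) h1a).trans hstep

theorem mul_pow_le_one_sub_lacoinKernel_pow_last (m : ℕ) (j : Fin (2 * n + 1)) (hj : (j : ℕ) ≤ n)
    (h : m + j < 2 * n) :
    b * (n : ℝ) ^ (-β) * (1 - a) ^ m
      ≤ 1 - (lacoinKernel β n a b c ^ m) j (Fin.last (2 * n)) := by
  have ha := lacoinKernel_left_nonneg hn hK
  have hB := lacoinKernel_detour_nonneg hn hK
  have hB1 := lacoinKernel_jump_nonneg hn hK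
  induction m generalizing j with
  | zero =>
    rw [pow_zero, pow_zero, Matrix.one_apply_ne (by rintro rfl; simp at h)]
    linarith
  | succ m ih =>
    have hstep := mul_le_one_sub_pow_succ_apply hK m j ⟨j + 1, by omega⟩ (Fin.last (2 * n))
    refine le_trans ?_ hstep
    rcases hj.eq_or_lt with hjn | hjn
    · rw [lacoinKernel_middle_succ hjn (congrArg (· + 1) hjn)]
      refine mul_le_mul_of_nonneg_left (le_trans ?_ (pow_le_one_sub_lacoinKernel_pow_last hn hK m
        ⟨j + 1, by omega⟩ (by grind) (by grind))) hB
      exact pow_le_pow_of_le_one (by linarith) (by linarith) (Nat.le_succ m)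
    · rw [lacoinKernel_apply_succ hjn.ne rfl, pow_succ', mul_left_comm]
      exact mul_le_mul_of_nonneg_left (ih ⟨j + 1, by omega⟩ hjn (by grind)) (by linarith)

theorem pow_le_lacoinKernel_pow_last (m : ℕ) (j : Fin (2 * n + 1)) (h : 2 * n ≤ m + j) :
    (1 - (a + c)) ^ m ≤ (lacoinKernel β n a b c ^ m) j (Fin.last (2 * n)) := by
  have hc := lacoinKernel_return_nonneg hn hK
  have he : 0 ≤ 1 - (a + c) := by linarith [lacoinKernel_hold_nonneg hn hK]
  induction m generalizing j with
  | zero =>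
    obtain rfl : j = Fin.last (2 * n) := Fin.ext (by rw [Fin.val_last]; omega)
    simp
  | succ m ih =>
    have hp : 0 ≤ (1 - (a + c)) ^ m := pow_nonneg he m
    have hlast := ih (Fin.last (2 * n)) (by simp)
    rw [pow_succ']
    rcases (Fin.le_last j).eq_or_lt with rfl | hj
    · refine le_trans ?_ (mul_le_pow_succ_apply hK m _ (Fin.last (2 * n)) _)
      rw [lacoinKernel_last_last hn, sub_sub]
      exact mul_le_mul_of_nonneg_left hlast he
    have hj : (j : ℕ) < 2 * n := hj
    have hnext := ih ⟨j + 1, by omega⟩ (by grind)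
    rcases eq_or_ne (j : ℕ) n with hjn | hjn
    · have hne : (⟨j + 1, by omega⟩ : Fin (2 * n + 1)) ≠ Fin.last (2 * n) :=
        Fin.ne_of_val_ne (by grind)
      refine le_trans ?_ (add_mul_le_pow_succ_apply hK m j _ hne)
      rw [lacoinKernel_middle_succ hjn (congrArg (· + 1) hjn), lacoinKernel_middle_last hn hjn]
      linarith [mul_le_mul_of_nonneg_left hnext (lacoinKernel_detour_nonneg hn hK),
        mul_le_mul_of_nonneg_left hlast (lacoinKernel_jump_nonneg hn hK), mul_nonneg hc hp]
    · refine le_trans ?_ (mul_le_pow_succ_apply hK m j ⟨j + 1, by omega⟩ _)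
      rw [lacoinKernel_apply_succ hjn rfl]
      exact mul_le_mul (by linarith) hnext hp (by linarith)

theorem pow_sub_le_lacoinKernel_pow_last (m : ℕ) (j : Fin (2 * n + 1)) (hj : (j : ℕ) ≤ n)
    (h : n + 1 ≤ m + j) :
    (1 - (a + c)) ^ m - b * (n : ℝ) ^ (-β)
      ≤ (lacoinKernel β n a b c ^ m) j (Fin.last (2 * n)) := by
  have ha := lacoinKernel_left_nonneg hn hK
  have hB := lacoinKernel_detour_nonneg hn hK
  have hB1 := lacoinKernel_jump_nonneg hn hK
  have hc := lacoinKernel_return_nonneg hn hK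
  have he : 0 ≤ 1 - (a + c) := by linarith [lacoinKernel_hold_nonneg hn hK]
  induction m generalizing j with
  | zero => omega
  | succ m ih =>
    have hp : 0 ≤ (1 - (a + c)) ^ m := pow_nonneg he m
    rw [pow_succ']
    rcases hj.eq_or_lt with hjn | hjn
    · have hlast := pow_le_lacoinKernel_pow_last hn hK m (Fin.last (2 * n)) (by simp)
      have hp1 : (1 - (a + c)) ^ m ≤ 1 := pow_le_one₀ he (by linarith)
      refine le_trans ?_ (mul_le_pow_succ_apply hK m j (Fin.last (2 * n)) _)
      rw [lacoinKernel_middle_last hn hjn]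
      linarith [mul_le_mul_of_nonneg_left hlast hB1, mul_nonneg hc hp,
        mul_le_mul_of_nonneg_left hp1 hB]
    · have hnext := ih ⟨j + 1, by omega⟩ hjn (by grind)
      refine le_trans ?_ (mul_le_pow_succ_apply hK m j ⟨j + 1, by omega⟩ _)
      rw [lacoinKernel_apply_succ hjn.ne rfl]
      linarith [mul_le_mul_of_nonneg_left hnext (by linarith : 0 ≤ 1 - a), mul_nonneg hc hp,
        mul_nonneg ha hB]

theorem one_sub_mul_le_lacoinKernel_pow_last {m : ℕ} (hm : n < m) (j : Fin (2 * n + 1)) :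
    1 - b * (n : ℝ) ^ (-β) - (a + c) * m
      ≤ (lacoinKernel β n a b c ^ m) j (Fin.last (2 * n)) := by
  have hbern := one_sub_mul_le_pow (e := a + c) (by linarith [lacoinKernel_hold_nonneg hn hK]) m
  rcases le_or_gt (j : ℕ) n with hj | hj
  · linarith [pow_sub_le_lacoinKernel_pow_last hn hK m j hj (by omega)]
  · linarith [pow_le_lacoinKernel_pow_last hn hK m j (by omega), lacoinKernel_detour_nonneg hn hK]

theorem one_sub_le_stationary_last {π : Fin (2 * n + 1) → ℝ}
    (hπ : IsStationaryDistribution (lacoinKernel β n a b c) π) :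
    1 - (a + c) * (2 * n : ℕ) ≤ π (Fin.last (2 * n)) :=
  calc 1 - (a + c) * (2 * n : ℕ) ≤ (1 - (a + c)) ^ (2 * n) :=
        one_sub_mul_le_pow (by linarith [lacoinKernel_hold_nonneg hn hK]) _
    _ = ∑ j, π j * (1 - (a + c)) ^ (2 * n) := by rw [← Finset.sum_mul, hπ.1.2, one_mul]
    _ ≤ ∑ j, π j * (lacoinKernel β n a b c ^ (2 * n)) j (Fin.last (2 * n)) :=
        Finset.sum_le_sum fun j _ => mul_le_mul_of_nonneg_left
          (pow_le_lacoinKernel_pow_last hn hK (2 * n) j (by omega)) (hπ.1.1 j)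
    _ = π (Fin.last (2 * n)) :=
        congrFun (vecMul_pow_eq_of_isStationaryDistribution hπ (2 * n)) _

variable {s ε : ℝ}

theorem heatKernel_lacoinKernel_le_chernoffRate_pow (hε : 0 < ε) (hε1 : ε < 1) (hs0 : 0 ≤ s)
    (hs : s ≤ (1 - ε) * n) :
    heatKernel (lacoinKernel β n a b c) s 0 (Fin.last (2 * n)) ≤ chernoffRate (-ε) ^ n := by
  have h := heatKernel_apply_le_of_pow_apply_le hK zero_le_one le_rfl hε hε1 hs0 hs
    (x := 0) (y := Fin.last (2 * n)) fun m hm => by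
      rw [lacoinKernel_pow_last_eq_zero (by omega) m 0 (by simpa using hm.le)]
      simp
  simpa using h

theorem heatKernel_lacoinKernel_le_one_sub (hε : 0 < ε) (hε1 : ε < 1) (hs0 : 0 ≤ s)
    (hs : s ≤ (1 - ε) * (2 * n : ℕ)) :
    heatKernel (lacoinKernel β n a b c) s 0 (Fin.last (2 * n))
      ≤ 1 - b * (n : ℝ) ^ (-β) * (1 - a * s - chernoffRate (-ε) ^ (2 * n)) := by
  have hB := lacoinKernel_detour_nonneg hn hK
  refine heatKernel_apply_le_of_pow_apply_le hK hB (lacoinKernel_left_nonneg hn hK) hε hε1 hs0 hs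
    fun m hm => ?_
  have hslow := mul_pow_le_one_sub_lacoinKernel_pow_last hn hK m 0 (Nat.zero_le _)
    (by simpa using hm)
  have hbern := one_sub_mul_le_pow (e := a)
    (by linarith [lacoinKernel_jump_nonneg hn hK]) m
  linarith [mul_le_mul_of_nonneg_left hbern hB]

theorem one_sub_le_heatKernel_lacoinKernel_of_two_mul_le (hε : 0 < ε)
    (hs : (1 + ε) * (2 * n : ℕ) ≤ s) (j : Fin (2 * n + 1)) :
    1 - (a + c) * s - chernoffRate ε ^ (2 * n)
      ≤ heatKernel (lacoinKernel β n a b c) s j (Fin.last (2 * n)) := by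
  have he := add_nonneg (lacoinKernel_left_nonneg hn hK) (lacoinKernel_return_nonneg hn hK)
  have h := le_heatKernel_apply_of_le_pow_apply hK le_rfl he hε hs (x := j)
    (y := Fin.last (2 * n)) fun m hm => by
      rw [sub_zero]
      exact (one_sub_mul_le_pow (by linarith [lacoinKernel_hold_nonneg hn hK]) m).trans
        (pow_le_lacoinKernel_pow_last hn hK m j (by omega))
  rwa [sub_zero] at h

theorem one_sub_le_heatKernel_lacoinKernel_of_le (hε : 0 < ε) (hs : (1 + ε) * n ≤ s)
    (j : Fin (2 * n + 1)) :
    1 - b * (n : ℝ) ^ (-β) - (a + c) * s - chernoffRate ε ^ n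
      ≤ heatKernel (lacoinKernel β n a b c) s j (Fin.last (2 * n)) :=
  le_heatKernel_apply_of_le_pow_apply hK (lacoinKernel_detour_nonneg hn hK)
    (add_nonneg (lacoinKernel_left_nonneg hn hK) (lacoinKernel_return_nonneg hn hK)) hε hs
    fun _ hm => one_sub_mul_le_lacoinKernel_pow_last hn hK hm j

end LacoinKernel

theorem le_of_reversible {n : ℕ} {a B c : ℝ} (hn : 2 ≤ n) (ha : 0 ≤ a) (hB : 0 < B)
    (hB1 : 0 ≤ 1 - a - B) (hsmall : a ≤ B * (1 - a))
    (hrev : B * c * (1 - a) ^ (n - 1) = (1 - a - B) * a ^ n) : c ≤ a := by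
  obtain ⟨m, rfl⟩ : ∃ m, n = m + 2 := Nat.exists_eq_add_of_le' hn
  have hpos : 0 < B * (1 - a) ^ (m + 1) := mul_pos hB (pow_pos (by linarith) _)
  have hpow : a ^ (m + 1) ≤ B * (1 - a) ^ (m + 1) :=
    calc a ^ (m + 1) ≤ (B * (1 - a)) ^ (m + 1) := pow_le_pow_left₀ ha hsmall _
      _ = B ^ (m + 1) * (1 - a) ^ (m + 1) := mul_pow _ _ _
      _ ≤ B * (1 - a) ^ (m + 1) := by
        gcongr
        · exact pow_nonneg (by linarith) _
        · exact pow_le_of_le_one hB.le (by linarith) (Nat.succ_ne_zero m)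
  refine le_of_mul_le_mul_left ?_ hpos
  calc B * (1 - a) ^ (m + 1) * c = B * c * (1 - a) ^ (m + 2 - 1) := mul_right_comm _ _ _
    _ = (1 - a - B) * (a ^ (m + 1) * a) := by rw [hrev]; ring
    _ ≤ 1 * (B * (1 - a) ^ (m + 1) * a) := by gcongr; linarith
    _ = B * (1 - a) ^ (m + 1) * a := one_mul _

section LacoinProduct

open Matrix
open scoped Finset

/-- The product, with weights `w`, of the chains `lacoinKernel β n (a i) (b i) (c i)`, whose
stationary distributions are `π i`. -/
structure IsLacoinProduct {ι : Type*} [Fintype ι] (β : ℝ) (n : ℕ) (w a b c : ι → ℝ)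
    (π : ι → Fin (2 * n + 1) → ℝ) : Prop where
  two_le : 2 ≤ n
  stochastic : ∀ i, lacoinKernel β n (a i) (b i) (c i) ∈ rowStochastic ℝ (Fin (2 * n + 1))
  stationary : ∀ i, IsStationaryDistribution (lacoinKernel β n (a i) (b i) (c i)) (π i)
  weight_nonneg : ∀ i, 0 ≤ w i
  sum_weight : ∑ i, w i = 1

namespace IsLacoinProduct

variable {ι : Type*} [Fintype ι] {β : ℝ} {n : ℕ} {w a b c : ι → ℝ}
  {π : ι → Fin (2 * n + 1) → ℝ} (hP : IsLacoinProduct β n w a b c π)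

include hP

lemma left_add_return_nonneg (i : ι) : 0 ≤ a i + c i :=
  add_nonneg (lacoinKernel_left_nonneg hP.two_le (hP.stochastic i))
    (lacoinKernel_return_nonneg hP.two_le (hP.stochastic i))

lemma left_add_return_mul_le_sum (i : ι) {s L : ℝ} (hL : 0 ≤ L) (hs : s ≤ L) :
    (a i + c i) * s ≤ (∑ j, (a j + c j)) * L :=
  (mul_le_mul_of_nonneg_left hs (hP.left_add_return_nonneg i)).trans <|
    mul_le_mul_of_nonneg_right (Finset.single_le_sum (f := fun j => a j + c j)
      (fun j _ => hP.left_add_return_nonneg j) (Finset.mem_univ i)) hL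

theorem one_sub_sum_le_prod_stationary_last :
    1 - (∑ i, (a i + c i)) * (2 * n) ≤ ∏ i, π i (Fin.last (2 * n)) := by
  rw [Finset.sum_mul]
  refine one_sub_sum_le_prod (fun i => (hP.stationary i).1.1 _)
    (fun i => (mem_Icc_of_mem_stdSimplex (hP.stationary i).1 _).2) fun i => ?_
  exact_mod_cast one_sub_le_stationary_last hP.two_le (hP.stochastic i) (hP.stationary i)

variable [DecidableEq ι] {t ε : ℝ}

theorem tvDistance_le (ht : 0 ≤ t) (hε : 0 < ε) {M B : ℝ} (hM : 2 ≤ M) (hB : 0 ≤ B)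
    (hb : ∀ i, b i * (n : ℝ) ^ (-β) ≤ B) (hlow : ∀ i, (1 + ε) * n ≤ t * w i)
    (hup : ∀ i, t * w i ≤ M * n)
    (hsmall : (∑ i, (a i + c i)) * (M * n) + chernoffRate ε ^ n + B ≤ 1 / 2) :
    tvDistance (productKernel w fun i => lacoinKernel β n (a i) (b i) (c i))
        (productDistribution π) t
      ≤ 1 - Real.exp (-(2 * ((∑ i, (a i + c i)) * (M * n) + Fintype.card ι * chernoffRate ε ^ n
        + B * #{i | t * w i < (1 + ε) * (2 * n)}))) := by
  have hρ0 : 0 ≤ chernoffRate ε := chernoffRate_nonneg (by linarith)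
  have hρn : chernoffRate ε ^ (2 * n) ≤ chernoffRate ε ^ n :=
    pow_le_pow_of_le_one hρ0 (chernoffRate_lt_one hε.ne').le (by omega)
  have hMn : 0 ≤ M * n := by positivity
  let e : ι → ℝ := fun i => (a i + c i) * (M * n) + chernoffRate ε ^ n
    + if t * w i < (1 + ε) * (2 * n) then B else 0
  have hleak : ∀ i, (a i + c i) * (t * w i) ≤ (a i + c i) * (M * n) := fun i =>
    mul_le_mul_of_nonneg_left (hup i) (hP.left_add_return_nonneg i)
  have hsum : ∑ i, e i = (∑ i, (a i + c i)) * (M * n) + Fintype.card ι * chernoffRate ε ^ n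
      + B * #{i | t * w i < (1 + ε) * (2 * n)} := by
    rw [Finset.sum_add_distrib, Finset.sum_add_distrib, ← Finset.sum_mul, ← Finset.sum_filter,
      Finset.sum_const, Finset.sum_const, nsmul_eq_mul, nsmul_eq_mul, Finset.card_univ, mul_comm B]
  rw [← hsum]
  refine tvDistance_productKernel_le_one_sub_exp hP.weight_nonneg hP.sum_weight hP.stochastic
    (fun i => (hP.stationary i).1) ht (z := fun _ => Fin.last (2 * n)) (fun i => ?_) (fun i => ?_)
    (fun i x => ?_) fun i => ?_
  · have := hP.left_add_return_mul_le_sum i hMn le_rfl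
    dsimp only [e]
    split_ifs <;> linarith
  · have := hP.left_add_return_nonneg i
    dsimp only [e]
    split_ifs <;> positivity
  · dsimp only [e]
    split_ifs with hi
    · linarith [one_sub_le_heatKernel_lacoinKernel_of_le hP.two_le (hP.stochastic i) hε (hlow i) x,
        hb i, hleak i]
    · linarith [one_sub_le_heatKernel_lacoinKernel_of_two_mul_le hP.two_le (hP.stochastic i) hε
        (by exact_mod_cast not_lt.1 hi) x, hleak i]
  · have hstat := one_sub_le_stationary_last hP.two_le (hP.stochastic i) (hP.stationary i)
    have htwo := mul_le_mul_of_nonneg_left (mul_le_mul_of_nonneg_right hM n.cast_nonneg)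
      (hP.left_add_return_nonneg i)
    have hρ := pow_nonneg hρ0 n
    push_cast at hstat
    dsimp only [e]
    split_ifs <;> linarith

theorem productKernel_mem_rowStochastic :
    productKernel w (fun i => lacoinKernel β n (a i) (b i) (c i))
      ∈ rowStochastic ℝ (ι → Fin (2 * n + 1)) :=
  _root_.productKernel_mem_rowStochastic hP.weight_nonneg hP.sum_weight hP.stochastic

theorem tvDistance_le_one (ht : 0 ≤ t) :
    tvDistance (productKernel w fun i => lacoinKernel β n (a i) (b i) (c i))
      (productDistribution π) t ≤ 1 := by
  have hπ := productDistribution_mem_stdSimplex fun i => (hP.stationary i).1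
  have h := tvDistance_le_of_le_apply hP.productKernel_mem_rowStochastic hπ ht (z := 0)
    (fun x => nonneg_of_mem_rowStochastic
      (heatKernel_mem_rowStochastic hP.productKernel_mem_rowStochastic ht)) (hπ.1 0)
  rwa [sub_zero] at h

theorem one_sub_sum_sub_prod_le_tvDistance (ht : 0 ≤ t) (x : ι → Fin (2 * n + 1)) :
    1 - (∑ i, (a i + c i)) * (2 * n)
        - ∏ i, heatKernel (lacoinKernel β n (a i) (b i) (c i)) (t * w i) (x i) (Fin.last (2 * n))
      ≤ tvDistance (productKernel w fun i => lacoinKernel β n (a i) (b i) (c i))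
        (productDistribution π) t :=
  (sub_le_sub_right hP.one_sub_sum_le_prod_stationary_last _).trans <|
    prod_sub_prod_le_tvDistance_productKernel hP.weight_nonneg hP.sum_weight hP.stochastic
      (fun i => (hP.stationary i).1) ht x fun _ => Fin.last (2 * n)

theorem le_tvDistance_of_exists (ht : 0 ≤ t) (hε : 0 < ε) (hε1 : ε < 1)
    (hslow : ∃ i, t * w i ≤ (1 - ε) * n) :
    1 - (∑ i, (a i + c i)) * (2 * n) - chernoffRate (-ε) ^ n
      ≤ tvDistance (productKernel w fun i => lacoinKernel β n (a i) (b i) (c i))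
        (productDistribution π) t := by
  obtain ⟨i, hi⟩ := hslow
  have htw : ∀ j, 0 ≤ t * w j := fun j => mul_nonneg ht (hP.weight_nonneg j)
  have hH : ∀ j, heatKernel (lacoinKernel β n (a j) (b j) (c j)) (t * w j)
      ∈ rowStochastic ℝ (Fin (2 * n + 1)) := fun j =>
    heatKernel_mem_rowStochastic (hP.stochastic j) (htw j)
  refine (sub_le_sub_left ?_ _).trans (hP.one_sub_sum_sub_prod_le_tvDistance ht fun _ => 0)
  rw [← Finset.mul_prod_erase Finset.univ _ (Finset.mem_univ i)]
  refine (mul_le_of_le_one_right (nonneg_of_mem_rowStochastic (hH i)) ?_).trans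
    (heatKernel_lacoinKernel_le_chernoffRate_pow hP.two_le (hP.stochastic i) hε hε1 (htw i) hi)
  exact Finset.prod_le_one (fun j _ => nonneg_of_mem_rowStochastic (hH j))
    fun j _ => le_one_of_mem_rowStochastic (hH j)

theorem le_tvDistance (ht : 0 ≤ t) (hε : 0 < ε) (hε1 : ε < 1) {B : ℝ} (hB : 0 ≤ B)
    (hb : ∀ i, B ≤ b i * (n : ℝ) ^ (-β))
    (hsmall : (∑ i, (a i + c i)) * (2 * n) + chernoffRate (-ε) ^ (2 * n) ≤ 1 / 2) :
    1 - (∑ i, (a i + c i)) * (2 * n)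
        - Real.exp (-(B / 2 * #{i | t * w i ≤ (1 - ε) * (2 * n)}))
      ≤ tvDistance (productKernel w fun i => lacoinKernel β n (a i) (b i) (c i))
        (productDistribution π) t := by
  have htw : ∀ i, 0 ≤ t * w i := fun i => mul_nonneg ht (hP.weight_nonneg i)
  have hH : ∀ i, heatKernel (lacoinKernel β n (a i) (b i) (c i)) (t * w i)
      ∈ rowStochastic ℝ (Fin (2 * n + 1)) := fun i =>
    heatKernel_mem_rowStochastic (hP.stochastic i) (htw i)
  refine (sub_le_sub_left ?_ _).trans (hP.one_sub_sum_sub_prod_le_tvDistance ht fun _ => 0)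
  have hsum : B / 2 * #{i | t * w i ≤ (1 - ε) * (2 * n)}
      = ∑ i, if t * w i ≤ (1 - ε) * (2 * n) then B / 2 else 0 := by
    rw [← Finset.sum_filter, Finset.sum_const, nsmul_eq_mul, mul_comm]
  rw [hsum]
  refine prod_le_exp_neg_sum (fun i => nonneg_of_mem_rowStochastic (hH i)) fun i => ?_
  split_ifs with hi
  · have hslow := heatKernel_lacoinKernel_le_one_sub hP.two_le (hP.stochastic i) hε hε1 (htw i)
      (by exact_mod_cast hi)
    have hleak : a i * (t * w i) ≤ (∑ j, (a j + c j)) * (2 * n) := by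
      refine le_trans ?_ (hP.left_add_return_mul_le_sum i (by positivity)
        (hi.trans (mul_le_of_le_one_left (by positivity) (by linarith))))
      exact mul_le_mul_of_nonneg_right (le_add_of_nonneg_right
        (lacoinKernel_return_nonneg hP.two_le (hP.stochastic i))) (htw i)
    refine hslow.trans (sub_le_sub_left ?_ 1)
    rw [div_eq_mul_inv]
    exact mul_le_mul (hb i) (by linarith) (by norm_num) (hB.trans (hb i))
  · linarith [le_one_of_mem_rowStochastic (hH i) (i := 0) (j := Fin.last (2 * n))]

end IsLacoinProduct

end LacoinProduct

section FinSums

open scoped Finset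

lemma sum_fin_succ_eq_sum_Icc {M : Type*} [AddCommMonoid M] (n : ℕ) (f : ℕ → M) :
    ∑ i : Fin n, f (i + 1) = ∑ i ∈ Finset.Icc 1 n, f i := by
  rw [Fin.sum_univ_eq_sum_range (fun i => f (i + 1)) n, Finset.range_eq_Ico,
    Finset.sum_Ico_add' f 0 n 1]
  rfl

lemma card_fin_succ_eq_card_Icc (n : ℕ) (P : ℕ → Prop) [DecidablePred P] :
    #{i : Fin n | P (i + 1)} = #{i ∈ Finset.Icc 1 n | P i} := by
  rw [Finset.card_filter, Finset.card_filter]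
  exact sum_fin_succ_eq_sum_Icc n fun i => if P i then 1 else 0

lemma tendsto_natCast_rpow_neg {β : ℝ} (hβ : 0 < β) :
    Tendsto (fun n : ℕ => (n : ℝ) ^ (-β)) atTop (𝓝 0) :=
  (tendsto_rpow_neg_atTop hβ).comp tendsto_natCast_atTop_atTop

end FinSums

section Weights

open scoped Finset

/-- The time elapsed in the `i`-th component chain when the product chain has run for time `t`. -/
noncomputable def componentTime (p : ℕ → ℕ → ℝ) (n : ℕ) (t : ℝ) (i : ℕ) : ℝ :=
  t * (p n i / ∑ k ∈ Finset.Icc 1 n, p n k)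

/-- Up to a bounded factor, the expected number of components that follow the slow path from `n`
to `2n`, among those whose weight is at most `γ`. -/
noncomputable def expectedDetours (β : ℝ) (p : ℕ → ℕ → ℝ) (γ : ℝ) (n : ℕ) : ℝ :=
  (n : ℝ) ^ (-β) * #{i ∈ Finset.Icc 1 n | p n i ≤ γ}

lemma expectedDetours_nonneg (β : ℝ) (p : ℕ → ℕ → ℝ) (γ : ℝ) (n : ℕ) :
    0 ≤ expectedDetours β p γ n := by
  unfold expectedDetours
  positivity

/-- Weights between `1` and `2` whose mean tends to `Q`. -/
structure IsModerateWeight (p : ℕ → ℕ → ℝ) (Q : ℝ) : Prop where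
  one_le : ∀ n, ∀ i ∈ Finset.Icc 1 n, 1 ≤ p n i
  le_two : ∀ n, ∀ i ∈ Finset.Icc 1 n, p n i ≤ 2
  tendsto_mean : Tendsto (fun n : ℕ => (∑ k ∈ Finset.Icc 1 n, p n k) / n) atTop (𝓝 Q)

namespace IsModerateWeight

variable {p : ℕ → ℕ → ℝ} {Q : ℝ} (hW : IsModerateWeight p Q)

include hW

lemma natCast_le_sum (n : ℕ) : (n : ℝ) ≤ ∑ k ∈ Finset.Icc 1 n, p n k := by
  simpa using Finset.card_nsmul_le_sum (Finset.Icc 1 n) (p n) 1 (hW.one_le n)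

lemma mean_pos : 0 < Q := by
  refine zero_lt_one.trans_le (ge_of_tendsto hW.tendsto_mean ?_)
  filter_upwards [eventually_gt_atTop 0] with n hn
  rw [one_le_div (Nat.cast_pos.2 hn)]
  exact hW.natCast_le_sum n

lemma tendsto_mean_ratio (θ : ℝ) :
    Tendsto (fun n : ℕ => θ * (Q * n / ∑ k ∈ Finset.Icc 1 n, p n k)) atTop (𝓝 θ) := by
  have h := ((hW.tendsto_mean.inv₀ hW.mean_pos.ne').const_mul Q).const_mul θ
  rw [mul_inv_cancel₀ hW.mean_pos.ne', mul_one] at h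
  refine h.congr fun n => ?_
  rw [inv_div, mul_div_assoc]

lemma mean_ratio_nonneg {θ : ℝ} (hθ : 0 ≤ θ) (n : ℕ) :
    0 ≤ θ * (Q * n / ∑ k ∈ Finset.Icc 1 n, p n k) := by
  have := hW.mean_pos
  have := n.cast_nonneg.trans (hW.natCast_le_sum n)
  positivity

omit hW in
lemma componentTime_eq (θ : ℝ) (n i : ℕ) : componentTime p n (θ * Q * (n : ℝ) ^ 2) i
    = p n i * (θ * (Q * n / ∑ k ∈ Finset.Icc 1 n, p n k)) * n := by
  unfold componentTime
  ring

lemma eventually_mul_le_componentTime {θ γ L : ℝ} (hθ : 0 ≤ θ) (hL : L < γ * θ) :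
    ∀ᶠ n : ℕ in atTop, ∀ i, γ ≤ p n i → L * n ≤ componentTime p n (θ * Q * (n : ℝ) ^ 2) i := by
  filter_upwards [((hW.tendsto_mean_ratio θ).const_mul γ).eventually_const_le hL] with n hn i hi
  rw [componentTime_eq]
  have := hW.mean_ratio_nonneg hθ n
  exact mul_le_mul_of_nonneg_right (hn.trans (by gcongr)) n.cast_nonneg

lemma eventually_componentTime_le_mul {θ γ L : ℝ} (hθ : 0 ≤ θ) (hL : γ * θ < L) :
    ∀ᶠ n : ℕ in atTop, ∀ i, p n i ≤ γ → componentTime p n (θ * Q * (n : ℝ) ^ 2) i ≤ L * n := by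
  filter_upwards [((hW.tendsto_mean_ratio θ).const_mul γ).eventually_le_const hL] with n hn i hi
  rw [componentTime_eq]
  have := hW.mean_ratio_nonneg hθ n
  exact mul_le_mul_of_nonneg_right (le_trans (by gcongr) hn) n.cast_nonneg

lemma eventually_mul_card_componentTime_lt_le {θ γ L : ℝ} (β : ℝ) (hθ : 0 ≤ θ)
    (hL : L * 2 < γ * θ) :
    ∀ᶠ n : ℕ in atTop,
      (n : ℝ) ^ (-β) * #{i : Fin n | componentTime p n (θ * Q * (n : ℝ) ^ 2) (i + 1) < L * (2 * n)}
        ≤ expectedDetours β p γ n := by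
  filter_upwards [hW.eventually_mul_le_componentTime hθ hL] with n hn
  rw [expectedDetours, card_fin_succ_eq_card_Icc n
    fun i => componentTime p n (θ * Q * (n : ℝ) ^ 2) i < L * (2 * n)]
  refine mul_le_mul_of_nonneg_left (Nat.cast_le.2 (Finset.card_le_card
    (Finset.monotone_filter_right _ fun i _ hi => ?_))) (by positivity)
  by_contra! hlt
  linarith [hn i hlt.le]

lemma eventually_expectedDetours_le_mul_card {θ γ L : ℝ} (β : ℝ) (hθ : 0 ≤ θ)
    (hL : γ * θ < L * 2) :
    ∀ᶠ n : ℕ in atTop, expectedDetours β p γ n ≤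
      (n : ℝ) ^ (-β) * #{i : Fin n | componentTime p n (θ * Q * (n : ℝ) ^ 2) (i + 1) ≤ L * (2 * n)}
        := by
  filter_upwards [hW.eventually_componentTime_le_mul hθ hL] with n hn
  rw [expectedDetours, card_fin_succ_eq_card_Icc n
    fun i => componentTime p n (θ * Q * (n : ℝ) ^ 2) i ≤ L * (2 * n)]
  refine mul_le_mul_of_nonneg_left (Nat.cast_le.2 (Finset.card_le_card
    (Finset.monotone_filter_right _ fun i _ hi => ?_))) (by positivity)
  linarith [hn i hi]

end IsModerateWeight

end Weights

section LacoinFamily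

open Matrix

theorem return_le_left_of_reversible {n : ℕ} (hn : 2 ≤ n) (hβ : 0 < β) {a b c : ℝ}
    (hK : lacoinKernel β n a b c ∈ rowStochastic ℝ (Fin (2 * n + 1)))
    (hrev : b * c * (1 - a) ^ (n - 1) * (n : ℝ) ^ (-β)
      = (1 - a - b * (n : ℝ) ^ (-β)) * a ^ n)
    {C : ℝ} (hC : 1 < C) (hnC : 2 * C ^ 2 ≤ n) (ha : a ≤ C * (n : ℝ) ^ (-β - 1)) (hb : C⁻¹ ≤ b) :
    c ≤ a := by
  have hn0 : (0 : ℝ) < n := by positivity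
  have hx0 : 0 < (n : ℝ) ^ (-β) := Real.rpow_pos_of_pos hn0 _
  have hx1 : (n : ℝ) ^ (-β) ≤ 1 :=
    Real.rpow_le_one_of_one_le_of_nonpos (by exact_mod_cast (by omega : 1 ≤ n)) (by linarith)
  have hb0 : 0 < b := (inv_pos.2 (by linarith)).trans_le hb
  have ha2 : 2 * a ≤ C⁻¹ * (n : ℝ) ^ (-β) :=
    calc 2 * a ≤ 2 * (C * ((n : ℝ) ^ (-β) / n)) := by rw [← Real.rpow_sub_one hn0.ne']; gcongr
      _ = C⁻¹ * (n : ℝ) ^ (-β) * (2 * C ^ 2 / n) := by field_simp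
      _ ≤ C⁻¹ * (n : ℝ) ^ (-β) :=
        mul_le_of_le_one_right (by positivity) ((div_le_one hn0).2 hnC)
  have hb2 : 2 * a ≤ b * (n : ℝ) ^ (-β) := ha2.trans (by gcongr)
  have ha1 : 2 * a ≤ 1 :=
    ha2.trans (mul_le_one₀ (inv_le_one_of_one_le₀ hC.le) hx0.le hx1)
  refine le_of_reversible hn (lacoinKernel_left_nonneg hn hK) (mul_pos hb0 hx0)
    (lacoinKernel_jump_nonneg hn hK) ?_ (by rw [← hrev]; ring)
  nlinarith [mul_pos hb0 hx0]

/-- The hypotheses on the component chains under which the mixing of their product is analysed,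
required for large `n` only. The bound on the sum makes every `π n i` concentrate at `2n`. -/
structure IsLacoinFamily (β : ℝ) (a b c : ℕ → ℕ → ℝ)
    (π : ∀ n : ℕ, ℕ → Fin (2 * n + 1) → ℝ) (C : ℝ) : Prop where
  beta_pos : 0 < β
  const_pos : 0 < C
  stochastic : ∀ᶠ n in atTop, ∀ i ∈ Finset.Icc 1 n,
    lacoinKernel β n (a n i) (b n i) (c n i) ∈ rowStochastic ℝ (Fin (2 * n + 1))
  stationary : ∀ᶠ n in atTop, ∀ i ∈ Finset.Icc 1 n,
    IsStationaryDistribution (lacoinKernel β n (a n i) (b n i) (c n i)) (π n i)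
  sum_le : ∀ᶠ n : ℕ in atTop, ∑ i ∈ Finset.Icc 1 n, (a n i + c n i) ≤ C * (n : ℝ) ^ (-β - 1)
  inv_le : ∀ᶠ n in atTop, ∀ i ∈ Finset.Icc 1 n, C⁻¹ ≤ b n i
  le : ∀ᶠ n in atTop, ∀ i ∈ Finset.Icc 1 n, b n i ≤ C

namespace IsLacoinFamily

variable {β : ℝ} {a b c : ℕ → ℕ → ℝ} {π : ∀ n : ℕ, ℕ → Fin (2 * n + 1) → ℝ} {C : ℝ}

theorem of_reversible (hβ : 0 < β)
    (hK : ∀ n i, 2 ≤ n → 1 ≤ i → i ≤ n →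
      lacoinKernel β n (a n i) (b n i) (c n i) ∈ rowStochastic ℝ (Fin (2 * n + 1)))
    (hπ : ∀ n i, 2 ≤ n → 1 ≤ i → i ≤ n →
      IsStationaryDistribution (lacoinKernel β n (a n i) (b n i) (c n i)) (π n i))
    (hrev : ∀ n i, 2 ≤ n → 1 ≤ i → i ≤ n →
      b n i * c n i * (1 - a n i) ^ (n - 1) * (n : ℝ) ^ (-β)
        = (1 - a n i - b n i * (n : ℝ) ^ (-β)) * a n i ^ n)
    (hC : 1 < C)
    (hsum : ∀ n : ℕ, 2 ≤ n → ∑ i ∈ Finset.Icc 1 n, a n i ≤ C * (n : ℝ) ^ (-β - 1))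
    (hb : ∀ n i, 2 ≤ n → 1 ≤ i → i ≤ n → C⁻¹ ≤ b n i ∧ b n i ≤ C) :
    IsLacoinFamily β a b c π (2 * C) where
  beta_pos := hβ
  const_pos := by linarith
  stochastic := by
    filter_upwards [eventually_ge_atTop 2] with n hn i hi
    exact hK n i hn (Finset.mem_Icc.1 hi).1 (Finset.mem_Icc.1 hi).2
  stationary := by
    filter_upwards [eventually_ge_atTop 2] with n hn i hi
    exact hπ n i hn (Finset.mem_Icc.1 hi).1 (Finset.mem_Icc.1 hi).2
  sum_le := by
    filter_upwards [eventually_ge_atTop 2,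
      tendsto_natCast_atTop_atTop.eventually_ge_atTop (2 * C ^ 2)] with n hn hnC
    have ha : ∀ i ∈ Finset.Icc 1 n, 0 ≤ a n i := fun i hi =>
      lacoinKernel_left_nonneg hn (hK n i hn (Finset.mem_Icc.1 hi).1 (Finset.mem_Icc.1 hi).2)
    have hca : ∀ i ∈ Finset.Icc 1 n, c n i ≤ a n i := fun i hi => by
      have ⟨h1, hin⟩ := Finset.mem_Icc.1 hi
      exact return_le_left_of_reversible hn hβ (hK n i hn h1 hin) (hrev n i hn h1 hin) hC hnC
        ((Finset.single_le_sum ha hi).trans (hsum n hn)) (hb n i hn h1 hin).1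
    rw [Finset.sum_add_distrib, two_mul, add_mul]
    exact add_le_add (hsum n hn) ((Finset.sum_le_sum hca).trans (hsum n hn))
  inv_le := by
    filter_upwards [eventually_ge_atTop 2] with n hn i hi
    exact (inv_anti₀ (by linarith) (by linarith)).trans
      (hb n i hn (Finset.mem_Icc.1 hi).1 (Finset.mem_Icc.1 hi).2).1
  le := by
    filter_upwards [eventually_ge_atTop 2] with n hn i hi
    linarith [(hb n i hn (Finset.mem_Icc.1 hi).1 (Finset.mem_Icc.1 hi).2).2]

end IsLacoinFamily

end LacoinFamily

section Asymptotics

open Matrix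
open scoped Finset

namespace IsLacoinFamily

variable {β : ℝ} {a b c : ℕ → ℕ → ℝ} {π : ∀ n : ℕ, ℕ → Fin (2 * n + 1) → ℝ} {C : ℝ}
  (hF : IsLacoinFamily β a b c π C)

include hF

theorem eventually_sum_mul_le {M δ : ℝ} (hM : 0 ≤ M) (hδ : 0 < δ) :
    ∀ᶠ n : ℕ in atTop, (∑ i : Fin n, (a n (i + 1) + c n (i + 1))) * (M * n) ≤ δ := by
  have hlim : Tendsto (fun n : ℕ => M * (C * (n : ℝ) ^ (-β))) atTop (𝓝 0) := by
    simpa using ((tendsto_natCast_rpow_neg hF.beta_pos).const_mul C).const_mul M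
  filter_upwards [hF.sum_le, hlim.eventually_le_const hδ, eventually_ne_atTop 0] with n hsum hn hn0
  have hn0' : (n : ℝ) ≠ 0 := Nat.cast_ne_zero.2 hn0
  rw [sum_fin_succ_eq_sum_Icc n fun i => a n i + c n i]
  calc (∑ i ∈ Finset.Icc 1 n, (a n i + c n i)) * (M * n)
      ≤ C * (n : ℝ) ^ (-β - 1) * (M * n) := by gcongr
    _ = M * (C * (n : ℝ) ^ (-β)) := by
      rw [Real.rpow_sub_one hn0']
      field_simp
    _ ≤ δ := hn

variable {p : ℕ → ℕ → ℝ} {Q : ℝ} (hW : IsModerateWeight p Q)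

include hW

theorem eventually_isLacoinProduct :
    ∀ᶠ n in atTop, IsLacoinProduct β n
      (fun i : Fin n => p n (i + 1) / ∑ k ∈ Finset.Icc 1 n, p n k) (fun i => a n (i + 1))
      (fun i => b n (i + 1)) (fun i => c n (i + 1)) (fun i => π n (i + 1)) := by
  filter_upwards [hF.stochastic, hF.stationary, eventually_ge_atTop 2] with n hK hπ hn
  have hmem : ∀ i : Fin n, (i : ℕ) + 1 ∈ Finset.Icc 1 n := fun i => by
    rw [Finset.mem_Icc]
    omega
  have hsum : 0 < ∑ k ∈ Finset.Icc 1 n, p n k :=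
    (Nat.cast_pos.2 (by omega)).trans_le (hW.natCast_le_sum n)
  refine ⟨hn, fun i => hK _ (hmem i), fun i => hπ _ (hmem i), fun i => ?_, ?_⟩
  · have := hW.one_le n _ (hmem i)
    positivity
  · rw [sum_fin_succ_eq_sum_Icc n fun i => p n i / ∑ k ∈ Finset.Icc 1 n, p n k, ← Finset.sum_div,
      div_self hsum.ne']

theorem eventually_antitone_distance :
    ∀ᶠ n in atTop, Antitone (lacoinProductDistance β a b c π p n) := by
  filter_upwards [hF.eventually_isLacoinProduct hW] with n hP
  exact tvDistance_antitone hP.productKernel_mem_rowStochastic _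

theorem eventually_distance_le {θ γ δ : ℝ} (hθ : 1 < θ) (hγ : 2 < γ * θ) (hδ : 0 < δ) :
    ∀ᶠ n : ℕ in atTop, lacoinProductDistance β a b c π p n (θ * Q * (n : ℝ) ^ 2)
      ≤ 1 - Real.exp (-(2 * (δ + C * expectedDetours β p γ n))) := by
  obtain ⟨ε, hε, hεlt⟩ : ∃ ε, 0 < ε ∧ ε < min (θ - 1) (γ * θ / 2 - 1) :=
    exists_between (lt_min (by linarith) (by linarith))
  obtain ⟨hε1, hε2⟩ := lt_min_iff.1 hεlt
  have hB : Tendsto (fun n : ℕ => C * (n : ℝ) ^ (-β)) atTop (𝓝 0) := by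
    simpa using (tendsto_natCast_rpow_neg hF.beta_pos).const_mul C
  have hρ0 := chernoffRate_nonneg (by linarith : -1 ≤ ε)
  have hρ1 := chernoffRate_lt_one hε.ne'
  filter_upwards [hF.eventually_isLacoinProduct hW, hF.le,
    hW.eventually_mul_le_componentTime (by linarith) (by linarith : 1 + ε < 1 * θ),
    hW.eventually_mul_card_componentTime_lt_le β (by linarith) (by linarith : (1 + ε) * 2 < γ * θ),
    hW.eventually_componentTime_le_mul (by linarith) (by linarith : 2 * θ < 2 * θ + 1),
    hF.eventually_sum_mul_le (M := 2 * θ + 1) (by linarith) (by positivity : 0 < δ / 2),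
    hF.eventually_sum_mul_le (M := 2 * θ + 1) (by linarith) (by norm_num : (0 : ℝ) < 1 / 6),
    (tendsto_self_mul_const_pow_of_lt_one hρ0 hρ1).eventually_le_const (by positivity : 0 < δ / 2),
    (tendsto_pow_atTop_nhds_zero_of_lt_one hρ0 hρ1).eventually_le_const
      (by norm_num : (0 : ℝ) < 1 / 6),
    hB.eventually_le_const (by norm_num : (0 : ℝ) < 1 / 6)]
    with n hP hb hone hdet htwo hleak hleak6 hρn hρ6 hB6
  have hmem : ∀ i : Fin n, (i : ℕ) + 1 ∈ Finset.Icc 1 n := fun i => by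
    rw [Finset.mem_Icc]
    omega
  have hQ := hW.mean_pos
  have hC := hF.const_pos
  have h := hP.tvDistance_le (t := θ * Q * (n : ℝ) ^ 2) (B := C * (n : ℝ) ^ (-β)) (by positivity) hε
    (by linarith) (by positivity)
    (fun i => mul_le_mul_of_nonneg_right (hb _ (hmem i)) (by positivity))
    (fun i => hone _ (hW.one_le n _ (hmem i))) (fun i => htwo _ (hW.le_two n _ (hmem i)))
    (by linarith)
  refine h.trans (sub_le_sub_left (Real.exp_le_exp.2 (neg_le_neg ?_)) 1)
  rw [Fintype.card_fin]
  refine mul_le_mul_of_nonneg_left (add_le_add (by linarith) ?_) zero_le_two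
  exact (mul_assoc _ _ _).trans_le (mul_le_mul_of_nonneg_left hdet hC.le)

theorem eventually_distance_le_one {θ : ℝ} (hθ : 0 ≤ θ) :
    ∀ᶠ n : ℕ in atTop, lacoinProductDistance β a b c π p n (θ * Q * (n : ℝ) ^ 2) ≤ 1 := by
  have hQ := hW.mean_pos
  filter_upwards [hF.eventually_isLacoinProduct hW] with n hP
  exact hP.tvDistance_le_one (by positivity)

theorem eventually_le_distance {θ γ δ : ℝ} (hθ : 0 < θ) (hγ : γ * θ < 2) (hδ : 0 < δ) :
    ∀ᶠ n : ℕ in atTop, 1 - δ - Real.exp (-(C⁻¹ / 2 * expectedDetours β p γ n))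
      ≤ lacoinProductDistance β a b c π p n (θ * Q * (n : ℝ) ^ 2) := by
  obtain ⟨ε, hε, hεlt⟩ : ∃ ε, 0 < ε ∧ ε < min 1 (1 - γ * θ / 2) :=
    exists_between (lt_min one_pos (by linarith))
  obtain ⟨hε1, hε2⟩ := lt_min_iff.1 hεlt
  have hρ : Tendsto (fun n : ℕ => chernoffRate (-ε) ^ (2 * n)) atTop (𝓝 0) :=
    (tendsto_pow_atTop_nhds_zero_of_lt_one (chernoffRate_nonneg (by linarith))
      (chernoffRate_lt_one (neg_ne_zero.2 hε.ne'))).comp (tendsto_id.const_mul_atTop' two_pos)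
  filter_upwards [hF.eventually_isLacoinProduct hW, hF.inv_le,
    hW.eventually_expectedDetours_le_mul_card β hθ.le (by linarith : γ * θ < (1 - ε) * 2),
    hF.eventually_sum_mul_le zero_le_two hδ,
    hF.eventually_sum_mul_le zero_le_two (by norm_num : (0 : ℝ) < 1 / 4),
    hρ.eventually_le_const (by norm_num : (0 : ℝ) < 1 / 4)]
    with n hP hb hdet hleak hleak4 hρ4
  have hQ := hW.mean_pos
  have hC := hF.const_pos
  have h := hP.le_tvDistance (t := θ * Q * (n : ℝ) ^ 2) (B := C⁻¹ * (n : ℝ) ^ (-β)) (by positivity)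
    hε hε1 (by positivity)
    (fun i => mul_le_mul_of_nonneg_right (hb _ (by rw [Finset.mem_Icc]; omega)) (by positivity))
    (by linarith)
  refine le_trans (sub_le_sub (by linarith) (Real.exp_le_exp.2 (neg_le_neg ?_))) h
  calc C⁻¹ / 2 * expectedDetours β p γ n
      ≤ C⁻¹ / 2 * _ := mul_le_mul_of_nonneg_left hdet (by positivity)
    _ = _ := by
      rw [← mul_assoc, div_mul_eq_mul_div]
      rfl

theorem tendsto_distance_one_of_exists {θ γ : ℝ} (hθ : 0 < θ) (hγ : γ * θ < 1)
    (hp : ∀ᶠ n in atTop, ∃ i ∈ Finset.Icc 1 n, p n i ≤ γ) :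
    Tendsto (fun n : ℕ => lacoinProductDistance β a b c π p n (θ * Q * (n : ℝ) ^ 2)) atTop
      (𝓝 1) := by
  obtain ⟨ε, hε, hεlt⟩ : ∃ ε, 0 < ε ∧ ε < min 1 (1 - γ * θ) :=
    exists_between (lt_min one_pos (by linarith))
  obtain ⟨hε1, hε2⟩ := lt_min_iff.1 hεlt
  refine tendsto_order.2 ⟨fun l hl => ?_, fun u hu => ?_⟩
  · filter_upwards [hF.eventually_isLacoinProduct hW, hp,
      hW.eventually_componentTime_le_mul hθ.le (by linarith : γ * θ < 1 - ε),
      hF.eventually_sum_mul_le zero_le_two (by linarith : 0 < (1 - l) / 3),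
      (tendsto_pow_atTop_nhds_zero_of_lt_one (chernoffRate_nonneg (by linarith : -1 ≤ -ε))
        (chernoffRate_lt_one (neg_ne_zero.2 hε.ne'))).eventually_le_const
        (by linarith : 0 < (1 - l) / 3)]
      with n hP ⟨i, hi, hpi⟩ hslow hleak hρ
    have hQ := hW.mean_pos
    obtain ⟨j, rfl⟩ : ∃ j : Fin n, (j : ℕ) + 1 = i := by
      rw [Finset.mem_Icc] at hi
      exact ⟨⟨i - 1, by omega⟩, Nat.sub_add_cancel hi.1⟩
    have h := hP.le_tvDistance_of_exists (t := θ * Q * (n : ℝ) ^ 2) (by positivity) hε hε1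
      ⟨j, hslow _ hpi⟩
    exact lt_of_lt_of_le (by linarith) h
  · filter_upwards [hF.eventually_distance_le_one hW hθ.le] with n hn
    exact hn.trans_lt hu

theorem tendsto_distance_one {θ γ : ℝ} (hθ : 0 < θ) (hγ : γ * θ < 2)
    (hdet : Tendsto (expectedDetours β p γ) atTop atTop) :
    Tendsto (fun n : ℕ => lacoinProductDistance β a b c π p n (θ * Q * (n : ℝ) ^ 2)) atTop
      (𝓝 1) := by
  have hexp : Tendsto (fun n => Real.exp (-(C⁻¹ / 2 * expectedDetours β p γ n))) atTop (𝓝 0) :=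
    Real.tendsto_exp_neg_atTop_nhds_zero.comp
      (hdet.const_mul_atTop (half_pos (inv_pos.2 hF.const_pos)))
  refine tendsto_order.2 ⟨fun l hl => ?_, fun u hu => ?_⟩
  · filter_upwards [hF.eventually_le_distance hW hθ hγ (by linarith : 0 < (1 - l) / 3),
      hexp.eventually_le_const (by linarith : 0 < (1 - l) / 3)] with n hn hn'
    linarith
  · filter_upwards [hF.eventually_distance_le_one hW hθ.le] with n hn
    exact hn.trans_lt hu

theorem tendsto_distance_zero {θ γ : ℝ} (hθ : 1 < θ) (hγ : 2 < γ * θ)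
    (hdet : Tendsto (expectedDetours β p γ) atTop (𝓝 0)) :
    Tendsto (fun n : ℕ => lacoinProductDistance β a b c π p n (θ * Q * (n : ℝ) ^ 2)) atTop
      (𝓝 0) := by
  refine tendsto_order.2 ⟨fun l hl => Eventually.of_forall fun n => ?_, fun u hu => ?_⟩
  · exact hl.trans_le (tvDistance_nonneg _ _ _)
  · have hdet' : Tendsto (fun n => C * expectedDetours β p γ n) atTop (𝓝 0) := by
      simpa using hdet.const_mul C
    filter_upwards [hF.eventually_distance_le hW hθ hγ (by linarith : 0 < u / 6),
      hdet'.eventually_le_const (by linarith : 0 < u / 6)] with n hn hn'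
    linarith [Real.one_sub_le_exp_neg (2 * (u / 6 + C * expectedDetours β p γ n))]

theorem exists_distance_le_one_sub {θ γ D : ℝ} (hθ : 1 < θ) (hγ : 2 < γ * θ)
    (hdet : ∀ᶠ n in atTop, expectedDetours β p γ n ≤ D) :
    ∃ δ > 0, ∀ᶠ n : ℕ in atTop,
      lacoinProductDistance β a b c π p n (θ * Q * (n : ℝ) ^ 2) ≤ 1 - δ := by
  refine ⟨Real.exp (-(2 * (1 + C * D))), Real.exp_pos _, ?_⟩
  filter_upwards [hF.eventually_distance_le hW hθ hγ one_pos, hdet] with n hn hn'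
  have := hF.const_pos
  exact hn.trans (by gcongr)

theorem exists_le_distance {θ γ D : ℝ} (hθ : 0 < θ) (hγ : γ * θ < 2) (hD : 0 < D)
    (hdet : ∀ᶠ n in atTop, D ≤ expectedDetours β p γ n) :
    ∃ δ > 0, ∀ᶠ n : ℕ in atTop,
      δ ≤ lacoinProductDistance β a b c π p n (θ * Q * (n : ℝ) ^ 2) := by
  have hC := inv_pos.2 hF.const_pos
  have hlt : Real.exp (-(C⁻¹ / 2 * D)) < 1 := Real.exp_lt_one_iff.2 (neg_lt_zero.2 (by positivity))
  refine ⟨(1 - Real.exp (-(C⁻¹ / 2 * D))) / 2, by linarith, ?_⟩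
  filter_upwards [hF.eventually_le_distance hW hθ hγ
    (by linarith : 0 < (1 - Real.exp (-(C⁻¹ / 2 * D))) / 2), hdet] with n hn hn'
  have : Real.exp (-(C⁻¹ / 2 * expectedDetours β p γ n)) ≤ Real.exp (-(C⁻¹ / 2 * D)) := by
    gcongr
  linarith

end IsLacoinFamily

end Asymptotics

section Cutoff

open scoped Finset

theorem isCutoffTime_mul_sq {d : ℕ → ℝ → ℝ} {κ Q : ℝ} (hκ : 0 < κ) (hQ : 0 < Q)
    (hzero : ∀ θ, κ < θ → Tendsto (fun n : ℕ => d n (θ * Q * (n : ℝ) ^ 2)) atTop (𝓝 0))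
    (hone : ∀ θ, 0 < θ → θ < κ → Tendsto (fun n : ℕ => d n (θ * Q * (n : ℝ) ^ 2)) atTop (𝓝 1)) :
    IsCutoffTime d fun n => κ * Q * (n : ℝ) ^ 2 := by
  have htime : ∀ (r : ℝ) (n : ℕ), r * (κ * Q * (n : ℝ) ^ 2) = r * κ * Q * (n : ℝ) ^ 2 :=
    fun r n => by ring
  simp only [IsCutoffTime, htime]
  refine ⟨?_, fun r hr => hzero _ (lt_mul_of_one_lt_left hκ hr),
    fun r hr0 hr1 => hone _ (mul_pos hr0 hκ) (mul_lt_of_lt_one_left hκ hr1)⟩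
  filter_upwards [eventually_gt_atTop 0] with n hn
  positivity

/-- A positive proportion of the weights is close to `1`. -/
def HasLightBulk (p : ℕ → ℕ → ℝ) : Prop :=
  ∀ γ : ℝ, 1 < γ → ∃ ρ > (0 : ℝ), ∀ᶠ n : ℕ in atTop, ρ * n ≤ #{i ∈ Finset.Icc 1 n | p n i ≤ γ}

lemma natCast_rpow_neg_mul_self (β : ℝ) {n : ℕ} (hn : n ≠ 0) :
    (n : ℝ) ^ (-β) * n = (n : ℝ) ^ (1 - β) := by
  rw [sub_eq_neg_add, Real.rpow_add_one (Nat.cast_ne_zero.2 hn)]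

lemma expectedDetours_le_rpow (β : ℝ) (p : ℕ → ℕ → ℝ) (γ : ℝ) {n : ℕ} (hn : n ≠ 0) :
    expectedDetours β p γ n ≤ (n : ℝ) ^ (1 - β) := by
  rw [← natCast_rpow_neg_mul_self β hn, expectedDetours]
  gcongr
  exact (Finset.card_filter_le _ _).trans_eq (Nat.card_Icc 1 n)

lemma IsModerateWeight.expectedDetours_eq_zero {p : ℕ → ℕ → ℝ} {Q γ : ℝ}
    (hW : IsModerateWeight p Q) (hγ : γ < 1) (β : ℝ) (n : ℕ) : expectedDetours β p γ n = 0 := by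
  rw [expectedDetours, Finset.filter_false_of_mem fun i hi =>
    not_le.2 (hγ.trans_le (hW.one_le n i hi)), Finset.card_empty, Nat.cast_zero, mul_zero]

namespace HasLightBulk

variable {p : ℕ → ℕ → ℝ} (hL : HasLightBulk p) {γ : ℝ} (hγ : 1 < γ)

include hL hγ

lemma exists_rpow_le_expectedDetours (β : ℝ) :
    ∃ ρ > 0, ∀ᶠ n : ℕ in atTop, ρ * (n : ℝ) ^ (1 - β) ≤ expectedDetours β p γ n := by
  obtain ⟨ρ, hρ, h⟩ := hL γ hγ
  refine ⟨ρ, hρ, ?_⟩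
  filter_upwards [h, eventually_ne_atTop 0] with n hn hn0
  rw [← natCast_rpow_neg_mul_self β hn0, mul_left_comm, expectedDetours]
  gcongr

lemma eventually_exists_le : ∀ᶠ n in atTop, ∃ i ∈ Finset.Icc 1 n, p n i ≤ γ := by
  obtain ⟨ρ, hρ, h⟩ := hL γ hγ
  filter_upwards [h, eventually_gt_atTop 0] with n hn hn0
  have hcard : (0 : ℝ) < #{i ∈ Finset.Icc 1 n | p n i ≤ γ} :=
    (mul_pos hρ (Nat.cast_pos.2 hn0)).trans_le hn
  simpa only [Finset.card_pos, Finset.filter_nonempty_iff] using Nat.cast_pos.1 hcard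

end HasLightBulk

namespace IsLacoinFamily

variable {β : ℝ} {a b c : ℕ → ℕ → ℝ} {π : ∀ n : ℕ, ℕ → Fin (2 * n + 1) → ℝ} {C : ℝ}
  (hF : IsLacoinFamily β a b c π C) {p : ℕ → ℕ → ℝ} {Q : ℝ} (hW : IsModerateWeight p Q)
  (hL : HasLightBulk p)

include hF hW hL

theorem isCutoffTime_of_lt_one (hβ : β < 1) :
    IsCutoffTime (lacoinProductDistance β a b c π p) fun n => 2 * Q * (n : ℝ) ^ 2 := by
  refine isCutoffTime_mul_sq two_pos hW.mean_pos (fun θ hθ => ?_) fun θ hθ0 hθ => ?_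
  · have hθ0 : 0 < θ := two_pos.trans hθ
    obtain ⟨γ, hγ, hγ1⟩ := exists_between ((div_lt_one hθ0).2 hθ)
    refine hF.tendsto_distance_zero hW (by linarith) ((div_lt_iff₀ hθ0).1 hγ) ?_
    exact tendsto_const_nhds.congr fun n => (hW.expectedDetours_eq_zero hγ1 β n).symm
  · obtain ⟨γ, hγ1, hγ⟩ := exists_between ((one_lt_div hθ0).2 hθ)
    refine hF.tendsto_distance_one hW hθ0 ((lt_div_iff₀ hθ0).1 hγ) ?_
    obtain ⟨ρ, hρ, hdet⟩ := hL.exists_rpow_le_expectedDetours hγ1 β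
    exact tendsto_atTop_mono' _ hdet (((tendsto_rpow_atTop (sub_pos.2 hβ)).comp
      tendsto_natCast_atTop_atTop).const_mul_atTop hρ)

theorem isCutoffTime_of_one_lt (hβ : 1 < β) :
    IsCutoffTime (lacoinProductDistance β a b c π p) fun n => Q * (n : ℝ) ^ 2 := by
  suffices h : IsCutoffTime (lacoinProductDistance β a b c π p) fun n => 1 * Q * (n : ℝ) ^ 2 by
    simpa only [one_mul] using h
  refine isCutoffTime_mul_sq one_pos hW.mean_pos (fun θ hθ => ?_) fun θ hθ0 hθ => ?_
  · refine hF.tendsto_distance_zero hW (γ := 2) hθ (by linarith) ?_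
    have hlim : Tendsto (fun n : ℕ => (n : ℝ) ^ (1 - β)) atTop (𝓝 0) := by
      simpa only [neg_sub] using tendsto_natCast_rpow_neg (sub_pos.2 hβ)
    refine squeeze_zero' (.of_forall fun n => expectedDetours_nonneg β p 2 n) ?_ hlim
    filter_upwards [eventually_ne_atTop 0] with n hn
    exact expectedDetours_le_rpow β p 2 hn
  · obtain ⟨γ, hγ1, hγ⟩ := exists_between ((one_lt_div hθ0).2 hθ)
    exact hF.tendsto_distance_one_of_exists hW hθ0 ((lt_div_iff₀ hθ0).1 hγ)
      (hL.eventually_exists_le hγ1)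

-- The distance at time `6/5 * Q * n²` stays away from `1` and at time `9/5 * Q * n²` away from `0`.
-- If `T` were a cutoff time, then `T n ≤ 3/2 * Q * n²` would contradict the latter at time
-- `6/5 * T n` and `T n > 3/2 * Q * n²` the former at time `4/5 * T n`.
theorem not_hasCutoff_of_eq_one (hβ : β = 1) :
    ¬ HasCutoff (lacoinProductDistance β a b c π p) := by
  rintro ⟨T, -, hzero, hone⟩
  obtain ⟨δ₁, hδ₁, hupper⟩ := hF.exists_distance_le_one_sub hW (θ := 6 / 5) (γ := 2) (D := 1)
    (by norm_num) (by norm_num) (by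
      filter_upwards [eventually_ne_atTop 0] with n hn
      simpa [hβ] using expectedDetours_le_rpow β p 2 hn)
  obtain ⟨ρ, hρ, hdet⟩ :=
    hL.exists_rpow_le_expectedDetours (by norm_num : (1 : ℝ) < 11 / 10) β
  obtain ⟨δ₂, hδ₂, hlower⟩ := hF.exists_le_distance hW (θ := 9 / 5) (γ := 11 / 10) (D := ρ)
    (by norm_num) (by norm_num) hρ (by simpa [hβ] using hdet)
  obtain ⟨n, hanti, hupper, hlower, hzero, hone⟩ :=
    ((hF.eventually_antitone_distance hW).and <| hupper.and <| hlower.and <|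
      ((hzero (6 / 5) (by norm_num)).eventually_lt_const hδ₂).and <|
      (hone (4 / 5) (by norm_num) (by norm_num)).eventually_const_lt
        (by linarith : 1 - δ₁ < 1)).exists
  rcases le_or_gt (T n) (3 / 2 * Q * (n : ℝ) ^ 2) with h | h
  · linarith [hanti (by linarith : 6 / 5 * T n ≤ 9 / 5 * Q * (n : ℝ) ^ 2)]
  · linarith [hanti (by linarith : 6 / 5 * Q * (n : ℝ) ^ 2 ≤ 4 / 5 * T n)]

theorem cutoff_of_hasLightBulk :
    (HasCutoff (lacoinProductDistance β a b c π p) ↔ β ≠ 1) ∧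
      (β < 1 →
        IsCutoffTime (lacoinProductDistance β a b c π p) fun n => 2 * Q * (n : ℝ) ^ 2) ∧
      (1 < β → IsCutoffTime (lacoinProductDistance β a b c π p) fun n => Q * (n : ℝ) ^ 2) := by
  have hlt := hF.isCutoffTime_of_lt_one hW hL
  have hgt := hF.isCutoffTime_of_one_lt hW hL
  refine ⟨⟨fun h hβ => hF.not_hasCutoff_of_eq_one hW hL hβ h, fun hβ => ?_⟩, hlt, hgt⟩
  exact hβ.lt_or_gt.elim (fun h => ⟨_, hlt h⟩) fun h => ⟨_, hgt h⟩

end IsLacoinFamily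

end Cutoff

section Examples

open scoped Finset Nat

lemma isModerateWeight_one_add {f : ℕ → ℕ → ℝ} {q : ℝ}
    (hf0 : ∀ n, ∀ i ∈ Finset.Icc 1 n, 0 ≤ f n i) (hf1 : ∀ n, ∀ i ∈ Finset.Icc 1 n, f n i ≤ 1)
    (hq : Tendsto (fun n : ℕ => (∑ k ∈ Finset.Icc 1 n, f n k) / n) atTop (𝓝 q)) :
    IsModerateWeight (fun n i => 1 + f n i) (1 + q) where
  one_le n i hi := le_add_of_nonneg_right (hf0 n i hi)
  le_two n i hi := by linarith [hf1 n i hi]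
  tendsto_mean := by
    refine (hq.const_add 1).congr' ?_
    filter_upwards [eventually_ne_atTop 0] with n hn
    rw [Finset.sum_add_distrib, add_div, Finset.sum_const, Nat.card_Icc, Nat.add_sub_cancel,
      nsmul_one, div_self (Nat.cast_ne_zero.2 hn)]

lemma sub_one_le_card_filter_Icc {n : ℕ} {P : ℕ → Prop} [DecidablePred P] {x : ℝ} (hx : x ≤ n)
    (hP : ∀ i ∈ Finset.Icc 1 n, (i : ℝ) ≤ x → P i) : x - 1 ≤ #{i ∈ Finset.Icc 1 n | P i} := by
  have hsub : Finset.Icc 1 ⌊x⌋₊ ⊆ {i ∈ Finset.Icc 1 n | P i} := fun i hi => by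
    have ⟨hi1, hix⟩ := Finset.mem_Icc.1 hi
    have hin : i ∈ Finset.Icc 1 n := Finset.mem_Icc.2 ⟨hi1, hix.trans (Nat.floor_le_of_le hx)⟩
    exact Finset.mem_filter.2 ⟨hin, hP i hin ((Nat.le_floor_iff' (by omega)).1 hix)⟩
  have hcard := Finset.card_le_card hsub
  rw [Nat.card_Icc, Nat.add_sub_cancel, ← Nat.cast_le (α := ℝ)] at hcard
  exact (Nat.sub_one_lt_floor x).le.trans hcard

lemma card_filter_Icc_le {n : ℕ} {P : ℕ → Prop} [DecidablePred P] {x : ℝ} (hx : 0 ≤ x)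
    (hP : ∀ i ∈ Finset.Icc 1 n, P i → (i : ℝ) ≤ x) : #{i ∈ Finset.Icc 1 n | P i} ≤ x := by
  have hsub : {i ∈ Finset.Icc 1 n | P i} ⊆ Finset.Icc 1 ⌊x⌋₊ := fun i hi => by
    have ⟨hin, hPi⟩ := Finset.mem_filter.1 hi
    exact Finset.mem_Icc.2 ⟨(Finset.mem_Icc.1 hin).1, Nat.le_floor (hP i hin hPi)⟩
  have hcard := Finset.card_le_card hsub
  rw [Nat.card_Icc, Nat.add_sub_cancel, ← Nat.cast_le (α := ℝ)] at hcard
  exact hcard.trans (Nat.floor_le hx)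

lemma sum_two_zpow_sub_le (n : ℕ) : ∑ k ∈ Finset.Icc 1 n, (2 : ℝ) ^ ((k : ℤ) - n) ≤ 2 := by
  induction n with
  | zero => simp
  | succ n ih =>
    have hstep : ∀ k : ℕ, (2 : ℝ) ^ ((k : ℤ) - (n + 1 : ℕ)) = (2 : ℝ) ^ ((k : ℤ) - n) * 2⁻¹ :=
      fun k => by rw [Nat.cast_succ, ← sub_sub, zpow_sub_one₀ two_ne_zero]
    rw [Finset.sum_Icc_succ_top (by omega), sub_self, zpow_zero]
    simp only [hstep, ← Finset.sum_mul]
    linarith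

theorem isModerateWeight_zpow :
    IsModerateWeight (fun n i => 1 + (2 : ℝ) ^ ((i : ℤ) - (n : ℤ))) 1 := by
  suffices h : IsModerateWeight (fun n i => 1 + (2 : ℝ) ^ ((i : ℤ) - (n : ℤ))) (1 + 0) by
    simpa only [add_zero] using h
  refine isModerateWeight_one_add (fun n i _ => by positivity) (fun n i hi => ?_) ?_
  · exact zpow_le_one_of_nonpos₀ one_le_two
      (sub_nonpos.2 (Nat.cast_le.2 (Finset.mem_Icc.1 hi).2))
  · refine squeeze_zero (fun n => by positivity) (fun n => ?_)
      (tendsto_const_div_atTop_nhds_zero_nat (2 : ℝ))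
    gcongr
    exact sum_two_zpow_sub_le n

theorem hasLightBulk_zpow : HasLightBulk fun n i => 1 + (2 : ℝ) ^ ((i : ℤ) - (n : ℤ)) := by
  intro γ hγ
  obtain ⟨k, hk⟩ := exists_pow_lt_of_lt_one (sub_pos.2 hγ) (by norm_num : (2⁻¹ : ℝ) < 1)
  refine ⟨1 / 2, by norm_num, ?_⟩
  filter_upwards [tendsto_natCast_atTop_atTop.eventually_ge_atTop (2 * (k + 1) : ℝ)] with n hn
  refine le_trans ?_ (sub_one_le_card_filter_Icc (sub_le_self (n : ℝ) k.cast_nonneg)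
    fun i _ hik => ?_)
  · linarith
  · have hle : i + k ≤ n := by exact_mod_cast le_sub_iff_add_le.1 hik
    have : (2 : ℝ) ^ ((i : ℤ) - n) ≤ 2 ^ (-(k : ℤ)) :=
      zpow_le_zpow_right₀ one_le_two (by omega)
    rw [zpow_neg, zpow_natCast, ← inv_pow] at this
    linarith

theorem tendsto_mean_of_monotoneOn {f : ℝ → ℝ} (hf : MonotoneOn f (Set.Icc 0 1)) :
    Tendsto (fun n : ℕ => (∑ k ∈ Finset.Icc 1 n, f (k / n)) / n) atTop (𝓝 (∫ x in 0..1, f x)) := by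
  have hlim : Tendsto (fun n : ℕ => (∫ x in 0..1, f x) + (f 1 - f 0) / n) atTop
      (𝓝 (∫ x in 0..1, f x)) := by
    simpa using (tendsto_const_div_atTop_nhds_zero_nat (f 1 - f 0)).const_add (∫ x in 0..1, f x)
  refine tendsto_of_tendsto_of_tendsto_of_le_of_le' tendsto_const_nhds hlim ?_ ?_
  all_goals
    filter_upwards [eventually_gt_atTop 0] with n hn
    have hn0 : (0 : ℝ) < n := Nat.cast_pos.2 hn
    have hmono : MonotoneOn (fun x : ℝ => f (x / n)) (Set.Icc (0 : ℝ) (0 + n)) := by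
      rw [zero_add]
      exact fun x hx y hy hxy => hf ⟨div_nonneg hx.1 hn0.le, (div_le_one hn0).2 hx.2⟩
        ⟨div_nonneg hy.1 hn0.le, (div_le_one hn0).2 hy.2⟩ (by gcongr)
    have hint : ∫ x in (0 : ℝ)..0 + n, f (x / n) = n * ∫ x in 0..1, f x := by
      rw [intervalIntegral.integral_comp_div f hn0.ne', zero_add, zero_div, div_self hn0.ne',
        smul_eq_mul]
    have hsum : ∑ k ∈ Finset.Icc 1 n, f (k / n) = ∑ k ∈ Finset.range n, f ((k + 1 : ℕ) / n) := by
      rw [← sum_fin_succ_eq_sum_Icc n fun k => f (k / n),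
        Fin.sum_univ_eq_sum_range fun k => f ((k + 1 : ℕ) / n)]
  · rw [le_div_iff₀ hn0, mul_comm, ← hint, hsum]
    simpa only [zero_add] using hmono.integral_le_sum
  · have hshift : ∑ k ∈ Finset.range n, f ((k + 1 : ℕ) / n)
        = ∑ k ∈ Finset.range n, f (k / n) + (f 1 - f 0) := by
      rw [← sub_eq_iff_eq_add', ← Finset.sum_sub_distrib,
        Finset.sum_range_sub fun k : ℕ => f (k / n), div_self hn0.ne', Nat.cast_zero, zero_div]
    rw [div_le_iff₀ hn0, add_mul, div_mul_cancel₀ _ hn0.ne', mul_comm, ← hint, hsum, hshift]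
    simpa only [zero_add, add_le_add_iff_right] using hmono.sum_le_integral

theorem isModerateWeight_rpow {α : ℝ} (hα : 0 < α) :
    IsModerateWeight (fun n i => 1 + ((i : ℝ) / (n : ℝ)) ^ α) ((α + 2) / (α + 1)) := by
  have hint : ∫ x in (0 : ℝ)..1, x ^ α = 1 / (α + 1) := by
    rw [integral_rpow (.inl (by linarith)), Real.one_rpow, Real.zero_rpow (by linarith), sub_zero]
  have hQ : (α + 2) / (α + 1) = 1 + 1 / (α + 1) := by
    field_simp
    ring
  rw [hQ, ← hint]
  refine isModerateWeight_one_add (fun n i _ => by positivity) (fun n i hi => ?_)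
    (tendsto_mean_of_monotoneOn ((Real.monotoneOn_rpow_Ici_of_exponent_nonneg hα.le).mono
      Set.Icc_subset_Ici_self))
  exact Real.rpow_le_one (by positivity)
    (div_le_one_of_le₀ (Nat.cast_le.2 (Finset.mem_Icc.1 hi).2) n.cast_nonneg) hα.le

theorem hasLightBulk_rpow {α : ℝ} (hα : 0 < α) :
    HasLightBulk fun n i => 1 + ((i : ℝ) / (n : ℝ)) ^ α := by
  intro γ hγ
  have hγ0 : 0 < γ - 1 := sub_pos.2 hγ
  obtain ⟨σ, hσ0, hσ⟩ : ∃ σ, 0 < σ ∧ σ < min 1 ((γ - 1) ^ α⁻¹) :=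
    exists_between (lt_min one_pos (Real.rpow_pos_of_pos hγ0 _))
  obtain ⟨hσ1, hσγ⟩ := lt_min_iff.1 hσ
  refine ⟨σ / 2, by positivity, ?_⟩
  filter_upwards [tendsto_natCast_atTop_atTop.eventually_ge_atTop (2 / σ),
    eventually_gt_atTop 0] with n hn hn0
  have hn0' : (0 : ℝ) < n := Nat.cast_pos.2 hn0
  rw [div_le_iff₀ hσ0] at hn
  refine le_trans ?_ (sub_one_le_card_filter_Icc (mul_le_of_le_one_left hn0'.le hσ1.le)
    fun i _ hi => ?_)
  · linarith
  · have : ((i : ℝ) / n) ^ α ≤ γ - 1 := by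
      rw [← Real.le_rpow_inv_iff_of_pos (by positivity) hγ0.le hα, div_le_iff₀ hn0']
      exact hi.trans (by gcongr)
    linarith

lemma sum_log_eq_log_factorial (n : ℕ) : ∑ k ∈ Finset.Icc 1 n, Real.log k = Real.log n ! := by
  rw [← Finset.prod_Ico_id_eq_factorial, Nat.cast_prod, Real.log_prod]
  · rfl
  intro k hk
  exact Nat.cast_ne_zero.2 (Nat.one_le_iff_ne_zero.1 (Finset.mem_Icc.1 hk).1)

theorem tendsto_log_factorial_div :
    Tendsto (fun n : ℕ => Real.log n ! / Real.log n / n) atTop (𝓝 1) := by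
  have hlim : Tendsto (fun n : ℕ => 1 - (Real.log n)⁻¹) atTop (𝓝 1) := by
    simpa using ((Real.tendsto_log_atTop.comp
      tendsto_natCast_atTop_atTop).inv_tendsto_atTop (α := ℕ)).const_sub 1
  refine tendsto_of_tendsto_of_tendsto_of_le_of_le' hlim tendsto_const_nhds ?_ ?_
  all_goals
    filter_upwards [eventually_gt_atTop 1] with n hn
    have hlog : 0 < Real.log n := Real.log_pos (Nat.one_lt_cast.2 hn)
    rw [div_div]
  · have hstirling := Stirling.le_log_factorial_stirling (by omega : n ≠ 0)
    have hpi : 0 ≤ Real.log (2 * Real.pi) := Real.log_nonneg (by linarith [Real.pi_gt_three])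
    rw [le_div_iff₀ (by positivity), sub_mul, inv_mul_cancel_left₀ hlog.ne']
    linarith
  · rw [div_le_one (by positivity), mul_comm, ← Real.log_pow]
    exact Real.log_le_log (by positivity) (by exact_mod_cast n.factorial_le_pow)

theorem isModerateWeight_log :
    IsModerateWeight (fun n i => 1 + Real.log i / Real.log n) 2 := by
  rw [← one_add_one_eq_two]
  refine isModerateWeight_one_add (fun n i _ => ?_) (fun n i hi => ?_) ?_
  · exact div_nonneg (Real.log_natCast_nonneg i) (Real.log_natCast_nonneg n)
  · obtain ⟨hi1, hin⟩ := Finset.mem_Icc.1 hi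
    exact div_le_one_of_le₀ (Real.log_le_log (Nat.cast_pos.2 hi1) (Nat.cast_le.2 hin))
      (Real.log_natCast_nonneg n)
  · simpa only [← Finset.sum_div, sum_log_eq_log_factorial] using tendsto_log_factorial_div

lemma one_add_log_div_log_le_iff {n i : ℕ} (hn : 1 < n) (hi : 1 ≤ i) (s : ℝ) :
    1 + Real.log i / Real.log n ≤ 1 + s ↔ (i : ℝ) ≤ (n : ℝ) ^ s := by
  rw [add_le_add_iff_left, div_le_iff₀ (Real.log_pos (Nat.one_lt_cast.2 hn)),
    Real.le_rpow_iff_log_le (Nat.cast_pos.2 hi) (Nat.cast_pos.2 (by omega))]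

lemma expectedDetours_log_le (β s : ℝ) {n : ℕ} (hn : 1 < n) :
    expectedDetours β (fun n i => 1 + Real.log i / Real.log n) (1 + s) n ≤ (n : ℝ) ^ (s - β) := by
  rw [sub_eq_neg_add, Real.rpow_add (by positivity), expectedDetours]
  gcongr
  exact card_filter_Icc_le (by positivity) fun i hi =>
    (one_add_log_div_log_le_iff hn (Finset.mem_Icc.1 hi).1 s).1

lemma le_expectedDetours_log (β : ℝ) {s : ℝ} (hs0 : 0 < s) (hs1 : s ≤ 1) :
    ∀ᶠ n : ℕ in atTop, 1 / 2 * (n : ℝ) ^ (s - β) ≤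
      expectedDetours β (fun n i => 1 + Real.log i / Real.log n) (1 + s) n := by
  filter_upwards [eventually_gt_atTop 1, ((tendsto_rpow_atTop hs0).comp
    tendsto_natCast_atTop_atTop).eventually_ge_atTop 2] with n hn hns
  rw [Function.comp_apply] at hns
  have hn1 : (1 : ℝ) ≤ n := Nat.one_le_cast.2 hn.le
  rw [sub_eq_neg_add, Real.rpow_add (by positivity), mul_left_comm, expectedDetours]
  gcongr
  refine le_trans ?_ (sub_one_le_card_filter_Icc ?_ fun i hi =>
    (one_add_log_div_log_le_iff hn (Finset.mem_Icc.1 hi).1 s).2)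
  · linarith
  · exact (Real.rpow_le_rpow_of_exponent_le hn1 hs1).trans_eq (Real.rpow_one _)

namespace IsLacoinFamily

variable {β : ℝ} {a b c : ℕ → ℕ → ℝ} {π : ∀ n : ℕ, ℕ → Fin (2 * n + 1) → ℝ} {C : ℝ}
  (hF : IsLacoinFamily β a b c π C)

include hF

theorem tendsto_distance_log_zero {θ s : ℝ} (hθ : 1 < θ) (hs : s < β) (hsθ : 2 < (1 + s) * θ) :
    Tendsto (fun n : ℕ => lacoinProductDistance β a b c π
      (fun n i => 1 + Real.log i / Real.log n) n (θ * 2 * (n : ℝ) ^ 2)) atTop (𝓝 0) := by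
  refine hF.tendsto_distance_zero isModerateWeight_log hθ hsθ ?_
  have hlim : Tendsto (fun n : ℕ => (n : ℝ) ^ (s - β)) atTop (𝓝 0) := by
    simpa only [neg_sub] using tendsto_natCast_rpow_neg (sub_pos.2 hs)
  refine squeeze_zero' (.of_forall fun n => expectedDetours_nonneg β _ _ n) ?_ hlim
  filter_upwards [eventually_gt_atTop 1] with n hn
  exact expectedDetours_log_le β s hn

theorem tendsto_distance_log_one {θ s : ℝ} (hθ : 0 < θ) (hβs : β < s) (hs1 : s ≤ 1)
    (hsθ : (1 + s) * θ < 2) :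
    Tendsto (fun n : ℕ => lacoinProductDistance β a b c π
      (fun n i => 1 + Real.log i / Real.log n) n (θ * 2 * (n : ℝ) ^ 2)) atTop (𝓝 1) :=
  hF.tendsto_distance_one isModerateWeight_log hθ hsθ <|
    tendsto_atTop_mono' _ (le_expectedDetours_log β (hF.beta_pos.trans hβs) hs1) <|
      ((tendsto_rpow_atTop (sub_pos.2 hβs)).comp
        tendsto_natCast_atTop_atTop).const_mul_atTop one_half_pos

theorem isCutoffTime_log :
    IsCutoffTime (lacoinProductDistance β a b c π fun n i => 1 + Real.log i / Real.log n)
      fun n => 4 * (n : ℝ) ^ 2 / (1 + min β 1) := by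
  have hμ : 0 < 1 + min β 1 := add_pos one_pos (lt_min hF.beta_pos one_pos)
  have htime : ∀ n : ℕ, 4 * (n : ℝ) ^ 2 / (1 + min β 1) = 2 / (1 + min β 1) * 2 * (n : ℝ) ^ 2 :=
    fun n => by ring
  simp only [htime]
  refine isCutoffTime_mul_sq (by positivity) two_pos (fun θ hθ => ?_) fun θ hθ0 hθ => ?_
  · have hθ1 : 1 < θ :=
      ((one_le_div hμ).2 (by linarith [min_le_right β 1])).trans_lt hθ
    obtain ⟨s, hsθ, hs⟩ : ∃ s, 2 / θ - 1 < s ∧ s < min β 1 :=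
      exists_between (sub_lt_iff_lt_add'.2 ((div_lt_comm₀ hμ (by linarith)).1 hθ))
    exact hF.tendsto_distance_log_zero hθ1 (lt_min_iff.1 hs).1
      ((div_lt_iff₀ (by linarith)).1 (sub_lt_iff_lt_add'.1 hsθ))
  · rcases le_or_gt 1 β with h1β | hβ1
    · rw [min_eq_right h1β, one_add_one_eq_two, div_self two_ne_zero] at hθ
      refine hF.tendsto_distance_one_of_exists isModerateWeight_log hθ0 ((one_mul θ).trans_lt hθ) ?_
      filter_upwards [eventually_ge_atTop 1] with n hn
      exact ⟨1, Finset.left_mem_Icc.2 hn, by simp⟩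
    · rw [min_eq_left hβ1.le] at hθ hμ
      obtain ⟨s, hβs, hs⟩ : ∃ s, β < s ∧ s < min 1 (2 / θ - 1) :=
        exists_between (lt_min hβ1 (lt_sub_iff_add_lt'.2 ((lt_div_comm₀ hθ0 hμ).1 hθ)))
      obtain ⟨hs1, hsθ⟩ := lt_min_iff.1 hs
      exact hF.tendsto_distance_log_one hθ0 hβs hs1.le
        ((lt_div_iff₀ hθ0).1 (lt_sub_iff_add_lt'.1 hsθ))

end IsLacoinFamily

end Examples

theorem proposition1p3_general {β : ℝ} {a b c : ℕ → ℕ → ℝ}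
    {π : ∀ n : ℕ, ℕ → Fin (2 * n + 1) → ℝ} {C : ℝ} (hF : IsLacoinFamily β a b c π C) :
    ((HasCutoff (lacoinProductDistance β a b c π
          (fun n i => 1 + (2 : ℝ) ^ ((i : ℤ) - (n : ℤ)))) ↔ β ≠ 1) ∧
      (β < 1 → IsCutoffTime (lacoinProductDistance β a b c π
          (fun n i => 1 + (2 : ℝ) ^ ((i : ℤ) - (n : ℤ))))
        (fun n => 2 * (n : ℝ) ^ 2)) ∧
      (1 < β → IsCutoffTime (lacoinProductDistance β a b c π
          (fun n i => 1 + (2 : ℝ) ^ ((i : ℤ) - (n : ℤ))))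
        (fun n => (n : ℝ) ^ 2))) ∧
    (∀ α : ℝ, 0 < α →
      (HasCutoff (lacoinProductDistance β a b c π
          (fun n i => 1 + ((i : ℝ) / (n : ℝ)) ^ α)) ↔ β ≠ 1) ∧
      (β < 1 → IsCutoffTime (lacoinProductDistance β a b c π
          (fun n i => 1 + ((i : ℝ) / (n : ℝ)) ^ α))
        (fun n => 2 * ((α + 2) / (α + 1)) * (n : ℝ) ^ 2)) ∧
      (1 < β → IsCutoffTime (lacoinProductDistance β a b c π
          (fun n i => 1 + ((i : ℝ) / (n : ℝ)) ^ α))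
        (fun n => (α + 2) / (α + 1) * (n : ℝ) ^ 2))) ∧
    IsCutoffTime (lacoinProductDistance β a b c π
        (fun n i => 1 + Real.log i / Real.log n))
      (fun n => 4 * (n : ℝ) ^ 2 / (1 + min β 1)) := by
  refine ⟨?_, fun α hα => hF.cutoff_of_hasLightBulk (isModerateWeight_rpow hα)
    (hasLightBulk_rpow hα), hF.isCutoffTime_log⟩
  simpa only [mul_one, one_mul] using
    hF.cutoff_of_hasLightBulk isModerateWeight_zpow hasLightBulk_zpow

theorem proposition1p3 (β : ℝ) (hβ : 0 < β) (a b c : ℕ → ℕ → ℝ)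
    (π : ∀ n : ℕ, ℕ → Fin (2 * n + 1) → ℝ)
    (hchain : ∀ n i : ℕ, 2 ≤ n → 1 ≤ i → i ≤ n →
      IsIrreducibleChain (lacoinKernel β n (a n i) (b n i) (c n i)) (π n i))
    (hrev : ∀ n i : ℕ, 2 ≤ n → 1 ≤ i → i ≤ n →
      b n i * c n i * (1 - a n i) ^ (n - 1) * (n : ℝ) ^ (-β)
        = (1 - a n i - b n i * (n : ℝ) ^ (-β)) * a n i ^ n)
    (C : ℝ) (hC : 1 < C)
    (hsum : ∀ n : ℕ, 2 ≤ n → ∑ i ∈ Finset.Icc 1 n, a n i ≤ C * (n : ℝ) ^ (-β - 1))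
    (hb : ∀ n i : ℕ, 2 ≤ n → 1 ≤ i → i ≤ n → C⁻¹ ≤ b n i ∧ b n i ≤ C) :
    -- weights `1 + 2 ^ (i - n)`
    ((HasCutoff (lacoinProductDistance β a b c π
          (fun n i => 1 + (2 : ℝ) ^ ((i : ℤ) - (n : ℤ)))) ↔ β ≠ 1) ∧
      (β < 1 → IsCutoffTime (lacoinProductDistance β a b c π
          (fun n i => 1 + (2 : ℝ) ^ ((i : ℤ) - (n : ℤ))))
        (fun n => 2 * (n : ℝ) ^ 2)) ∧
      (1 < β → IsCutoffTime (lacoinProductDistance β a b c π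
          (fun n i => 1 + (2 : ℝ) ^ ((i : ℤ) - (n : ℤ))))
        (fun n => (n : ℝ) ^ 2))) ∧
    -- weights `1 + (i / n) ^ α`
    (∀ α : ℝ, 0 < α →
      (HasCutoff (lacoinProductDistance β a b c π
          (fun n i => 1 + ((i : ℝ) / (n : ℝ)) ^ α)) ↔ β ≠ 1) ∧
      (β < 1 → IsCutoffTime (lacoinProductDistance β a b c π
          (fun n i => 1 + ((i : ℝ) / (n : ℝ)) ^ α))
        (fun n => 2 * ((α + 2) / (α + 1)) * (n : ℝ) ^ 2)) ∧
      (1 < β → IsCutoffTime (lacoinProductDistance β a b c π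
          (fun n i => 1 + ((i : ℝ) / (n : ℝ)) ^ α))
        (fun n => (α + 2) / (α + 1) * (n : ℝ) ^ 2))) ∧
    -- weights `1 + log i / log n`
    IsCutoffTime (lacoinProductDistance β a b c π
        (fun n i => 1 + Real.log i / Real.log n))
      (fun n => 4 * (n : ℝ) ^ 2 / (1 + min β 1)) :=
  proposition1p3_general (.of_reversible hβ (fun n i h2 h1 hi => (hchain n i h2 h1 hi).1)
    (fun n i h2 h1 hi => (hchain n i h2 h1 hi).2.2) hrev hC hsum hb)
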